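/- A simply connected hyperbolic region is an open simply connected set $D\subsetneq\mathbb{C}$. Let $\lambda_D$ be its hyperbolic density of curvature $-4$, that is, $\lambda_D(p(\zeta))\,|p'(\zeta)|=1/(1-|\zeta|^2)$ for $|\zeta|<1$, where $p$ is any holomorphic universal covering of $D$ by the unit disk, and let $$h_D(z_1,z_2)=\inf_\gamma\int_\gamma\lambda_D(z)\,|dz|$$ be the hyperbolic distance. For a region $G\subsetneq\mathbb{C}$ let $\delta_G(w)$ be the Euclidean distance from $w\in G$ to $\partial G$, and let $$k_G(w_1,w_2)=\inf_\gamma\int_\gamma\frac{|dw|}{\delta_G(w)}$$ be the quasihyperbolic distance. Both infima are over all rectifiable paths $\gamma$ that join the two points inside the region. If $D$ is a simply connected hyperbolic region and $f$ is a conformal mapping in $D$ (analytic and injective, with values in $\mathbb{C}$), then for all $z_1,z_2\in D$ both distances below are finite and $$h_D(z_1,z_2)\le k_{f(D)}(f(z_1),f(z_2))\le 4\,h_D(z_1,z_2).$$ The constants are best possible: if $c\ge 0$ satisfies $c\,h_D(z_1,z_2)\le k_{f(D)}(f(z_1),f(z_2))$ for all such $D$, $f$, $z_1$, $z_2$, then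 $c\le 1$; and if $C\ge 0$ satisfies $k_{f(D)}(f(z_1),f(z_2))\le C\,h_D(z_1,z_2)$ for all such $D$, $f$, $z_1$, $z_2$, then $C\ge 4$. -/

import Mathlib

open Set Metric MeasureTheory
open scoped ENNReal NNReal

namespace HypMetric

noncomputable section

/-- `p` restricts to a holomorphic covering map of the open unit disk onto `D`. As the disk is
simply connected, this is a universal covering of `D`. Values of `p` off the disk are irrelevant. -/
structure IsUniversalCover (p : ℂ → ℂ) (D : Set ℂ) : Prop where
  differentiableOn : DifferentiableOn ℂ p (ball 0 1)
  image_eq : p '' ball 0 1 = D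
  isCovering : IsCoveringMapOn (fun ζ : ball (0 : ℂ) 1 => p ζ) D

/-- The density `λ_D` of the hyperbolic metric of curvature `-4`. It is given by
`λ_D (p ζ) * |p' ζ| = 1 / (1 - |ζ|²)` for a holomorphic universal covering `p` of `D` by the
unit disk. The value does not depend on `p` or on the preimage `ζ` of `w`, so the infimum below
is over a family of equal numbers. (It is `∞` if there is no such `p` or if `w ∉ D`.) -/
def hyperbolicDensity (D : Set ℂ) (w : ℂ) : ℝ≥0∞ :=
  ⨅ (p : ℂ → ℂ) (_ : IsUniversalCover p D) (ζ : ℂ) (_ : ζ ∈ ball (0 : ℂ) 1) (_ : p ζ = w),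
    ENNReal.ofReal (1 / ((1 - ‖ζ‖ ^ 2) * ‖deriv p ζ‖))

/-- The density `1 / δ_D` of the quasihyperbolic metric, where `δ_D w` is the Euclidean distance
from `w` to the boundary of `D`. -/
def quasihyperbolicDensity (D : Set ℂ) (w : ℂ) : ℝ≥0∞ :=
  (infEDist w (frontier D))⁻¹

/-- `γ`, restricted to `[0, 1]`, is a rectifiable path in `D` from `z` to `w`. A rectifiable path is
taken in a Lipschitz parametrization: every Lipschitz path has finite length, and every path of
finite length is Lipschitz when it is parametrized on `[0, 1]` proportionally to arc length. -/
structure IsRectifiablePath (D : Set ℂ) (z w : ℂ) (γ : ℝ → ℂ) : Prop where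
  lipschitz : ∃ K : ℝ≥0, LipschitzOnWith K γ (Icc 0 1)
  mapsTo : MapsTo γ (Icc 0 1) D
  source : γ 0 = z
  target : γ 1 = w

/-- The line integral `∫_γ ρ |dz|` with respect to arc length. A Lipschitz path is differentiable
almost everywhere, and its arc length element is `|γ' t| dt`. -/
def lineIntegral (ρ : ℂ → ℝ≥0∞) (γ : ℝ → ℂ) : ℝ≥0∞ :=
  ∫⁻ t in Icc (0 : ℝ) 1, ρ (γ t) * ‖deriv γ t‖ₑ

/-- The infimum of `∫_γ ρ |dz|` over all rectifiable paths `γ` in `D` from `z` to `w`. -/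
def pathDist (ρ : ℂ → ℝ≥0∞) (D : Set ℂ) (z w : ℂ) : ℝ≥0∞ :=
  ⨅ (γ : ℝ → ℂ) (_ : IsRectifiablePath D z w γ), lineIntegral ρ γ

/-- The hyperbolic distance `h_D`. -/
def hyperbolicDist (D : Set ℂ) (z w : ℂ) : ℝ≥0∞ :=
  pathDist (hyperbolicDensity D) D z w

/-- The quasihyperbolic distance `k_D`. -/
def quasihyperbolicDist (D : Set ℂ) (z w : ℂ) : ℝ≥0∞ :=
  pathDist (quasihyperbolicDensity D) D z w

/-- A simply connected hyperbolic region: an open, simply connected (in particular nonempty and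
connected) proper subset of the plane. Its complement automatically has at least two points, since
a once punctured plane is not simply connected. -/
structure IsSimplyConnectedRegion (D : Set ℂ) : Prop where
  isOpen : IsOpen D
  isSimplyConnected : IsSimplyConnected D
  ne_univ : D ≠ univ

/-- A conformal mapping in `D`: analytic and univalent. -/
structure IsConformalMapping (f : ℂ → ℂ) (D : Set ℂ) : Prop where
  differentiableOn : DifferentiableOn ℂ f D
  injOn : InjOn f D

end

end HypMetric

/-! The theorem is the integrated form of a pointwise comparison of densities, `λ_D ≤ |f'| /
(δ_{f(D)} ∘ f) ≤ 4 λ_D`. Since `D` is simply connected, a universal covering `p` of `D` by the disk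
is injective, so `g = f ∘ p` maps the disk conformally onto `f(D)`. At `z = p ζ` the comparison
becomes `δ ≤ (1 - |ζ|²)|g'(ζ)| ≤ 4δ`, where `δ` is the distance from `g ζ` to the boundary of
`f(D)`. The left half is the Schwarz lemma for the inverse of `g` on the largest disk about `g ζ`
(`radius_le_of_ball_subset_image`); the right half is the Koebe quarter theorem (`koebe_quarter`).
`pathDist_map_le` carries density bounds over to distances, along `f` for the upper bound and along
its inverse for the lower one.

The density is an infimum over coverings. Lower bounds for it are checked on every covering and
upper bounds on a single one, so its independence of the covering is never needed. Existence of a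
covering is needed, since otherwise the density would be infinite; it comes from the Riemann mapping
theorem, proved by Koebe's extremal argument. The quarter theorem is reduced by a square root and a
Moebius map to `|w'(0)| ≤ 1` for univalent `w` with `w(a) w(b) ≠ 1`, which follows by comparing
logarithmic areas.

For sharpness take `f = id`. In the unit disk, `h(0, x) ≥ x` and `k(0, x) ≤ x / (1 - x)`, and `x`
may be small. In the slit plane, the points `1` and `e` satisfy `k ≥ 1` and `h ≤ 1/4`. -/

namespace HypMetric

open Filter
open scoped Topology

/-! ### Inverses of univalent functions -/

section Univalent

variable {f : ℂ → ℂ} {U : Set ℂ}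

/-- The open mapping alternative: a function constant near `z` cannot be injective there, because
`z` is not isolated in the plane. -/
theorem nhds_le_map_nhds_of_injOn (hU : IsOpen U) (hf : DifferentiableOn ℂ f U) (hinj : InjOn f U)
    {z : ℂ} (hz : z ∈ U) : 𝓝 (f z) ≤ map f (𝓝 z) := by
  refine ((hf.analyticAt (hU.mem_nhds hz)).eventually_constant_or_nhds_le_map_nhds).resolve_left ?_
  intro h
  have h1 : ∀ᶠ w in 𝓝 z, w = z := by
    filter_upwards [h, hU.mem_nhds hz] with w hw hwU using hinj hwU hz hw
  have h2 : {z} ∈ 𝓝 z := h1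
  exact (not_isOpen_singleton z) (isOpen_singleton_iff_nhds_eq_pure z |>.2
    (le_antisymm (le_pure_iff.2 h2) (pure_le_nhds z)))

theorem isOpen_image_of_injOn (hU : IsOpen U) (hf : DifferentiableOn ℂ f U) (hinj : InjOn f U) :
    IsOpen (f '' U) := by
  rw [isOpen_iff_mem_nhds]
  rintro _ ⟨z, hz, rfl⟩
  exact nhds_le_map_nhds_of_injOn hU hf hinj hz (image_mem_map (hU.mem_nhds hz))

theorem continuousOn_of_leftInvOn (hU : IsOpen U) (hf : DifferentiableOn ℂ f U)
    {g : ℂ → ℂ} (hg : LeftInvOn g f U) : ContinuousOn g (f '' U) := by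
  rintro _ ⟨z, hz, rfl⟩
  apply ContinuousAt.continuousWithinAt
  have h := nhds_le_map_nhds_of_injOn hU hf hg.injOn hz
  have h1 : Tendsto g (map f (𝓝 z)) (𝓝 z) := by
    rw [tendsto_map'_iff]
    refine tendsto_id.congr' ?_
    filter_upwards [hU.mem_nhds hz] with w hw using (hg hw).symm
  rw [ContinuousAt, hg hz]
  exact h1.mono_left h

/-- The inverse of an injective holomorphic function is holomorphic. -/
theorem differentiableOn_of_leftInvOn (hU : IsOpen U) (hf : DifferentiableOn ℂ f U)
    {g : ℂ → ℂ} (hg : LeftInvOn g f U) : DifferentiableOn ℂ g (f '' U) := by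
  have hinj := hg.injOn
  have hopen := isOpen_image_of_injOn hU hf hinj
  have hgc := continuousOn_of_leftInvOn hU hf hg
  have hreg : ∀ w ∈ U, deriv f w ≠ 0 → DifferentiableAt ℂ g (f w) := by
    intro w hw hne
    have h1 : HasDerivAt f (deriv f w) (g (f w)) := by
      rw [hg hw]; exact (hf.differentiableAt (hU.mem_nhds hw)).hasDerivAt
    refine (HasDerivAt.of_local_left_inverse (hgc.continuousAt (hopen.mem_nhds ⟨w, hw, rfl⟩))
      h1 hne ?_).differentiableAt
    filter_upwards [hopen.mem_nhds (mem_image_of_mem f hw)] with y hy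
    obtain ⟨x, hx, rfl⟩ := hy
    rw [hg hx]
  rintro _ ⟨z, hz, rfl⟩
  apply DifferentiableAt.differentiableWithinAt
  -- Zeros of `f'` are isolated, for otherwise `f` would be constant on a disk. Hence `g` is
  -- holomorphic on a punctured neighbourhood of `f z`; being continuous at `f z`, it has a
  -- removable singularity there.
  have hev : ∀ᶠ w in 𝓝[≠] z, deriv f w ≠ 0 := by
    have han : AnalyticAt ℂ (deriv f) z := (hf.analyticAt (hU.mem_nhds hz)).deriv
    refine han.eventually_eq_zero_or_eventually_ne_zero.resolve_left fun h ↦ ?_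
    obtain ⟨r, hr, hball⟩ := Metric.mem_nhds_iff.1 (inter_mem (hU.mem_nhds hz) h)
    have hconst : ∀ w ∈ ball z r, f w = f z := by
      intro w hw
      refine (convex_ball z r).is_const_of_fderivWithin_eq_zero (𝕜 := ℂ) (f := f)
        (hf.mono fun x hx ↦ (hball hx).1) (fun x hx ↦ ?_) hw (mem_ball_self hr)
      rw [fderivWithin_of_isOpen isOpen_ball hx]
      ext
      simpa using (hball hx).2
    have hw : z + (r / 2 : ℝ) ∈ ball z r := by
      simp [abs_of_pos hr, hr]
    have := hinj (hball hw).1 hz (hconst _ hw)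
    simp [hr.ne'] at this
  obtain ⟨V, hV, hVo, hzV⟩ := _root_.mem_nhds_iff.1 (eventually_nhdsWithin_iff.1 hev)
  have hVU : IsOpen (V ∩ U) := hVo.inter hU
  have himg : f '' (V ∩ U) ∈ 𝓝 (f z) :=
    (isOpen_image_of_injOn hVU (hf.mono inter_subset_right)
      (hinj.mono inter_subset_right)).mem_nhds ⟨z, ⟨hzV, hz⟩, rfl⟩
  refine ((Complex.differentiableOn_compl_singleton_and_continuousAt_iff himg).1
    ⟨?_, hgc.continuousAt (hopen.mem_nhds ⟨z, hz, rfl⟩)⟩).differentiableAt himg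
  rintro _ ⟨⟨w, hw, rfl⟩, hne⟩
  refine (hreg w hw.2 (hV hw.1 ?_)).differentiableWithinAt
  rintro rfl
  exact hne rfl

theorem deriv_mul_deriv_of_leftInvOn (hU : IsOpen U) (hf : DifferentiableOn ℂ f U)
    {g : ℂ → ℂ} (hg : LeftInvOn g f U) {z : ℂ} (hz : z ∈ U) :
    deriv g (f z) * deriv f z = 1 := by
  have hopen := isOpen_image_of_injOn hU hf hg.injOn
  have h1 := ((differentiableOn_of_leftInvOn hU hf hg).differentiableAt
    (hopen.mem_nhds ⟨z, hz, rfl⟩)).hasDerivAt.comp z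
    (hf.differentiableAt (hU.mem_nhds hz)).hasDerivAt
  refine h1.unique ((hasDerivAt_id z).congr_of_eventuallyEq ?_)
  filter_upwards [hU.mem_nhds hz] with w hw using hg hw

/-- Differentiability of the inverse was obtained without this fact, so the chain rule for `g ∘ f =
id` now yields it. -/
theorem deriv_ne_zero_of_injOn (hU : IsOpen U) (hf : DifferentiableOn ℂ f U) (hinj : InjOn f U)
    {z : ℂ} (hz : z ∈ U) : deriv f z ≠ 0 :=
  right_ne_zero_of_mul_eq_one (deriv_mul_deriv_of_leftInvOn hU hf hinj.leftInvOn_invFunOn hz)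

end Univalent

/-! ### Automorphisms of the unit disk -/

section Moebius

/-- The automorphism `z ↦ (z - a) / (1 - conj a * z)` of the unit disk. -/
noncomputable def discAut (a z : ℂ) : ℂ := (z - a) / (1 - starRingEnd ℂ a * z)

theorem discAut_denom_ne_zero {a z : ℂ} (ha : ‖a‖ < 1) (hz : ‖z‖ < 1) :
    1 - starRingEnd ℂ a * z ≠ 0 := by
  intro h
  have h1 : starRingEnd ℂ a * z = 1 := (sub_eq_zero.1 h).symm
  have h2 : ‖a‖ * ‖z‖ = 1 := by simpa using congrArg norm h1
  nlinarith [norm_nonneg a, norm_nonneg z]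

theorem one_sub_normSq_ne_zero {a : ℂ} (ha : ‖a‖ < 1) : (1 : ℝ) - ‖a‖ ^ 2 ≠ 0 := by
  nlinarith [norm_nonneg a]

theorem norm_discAut_lt_one {a z : ℂ} (ha : ‖a‖ < 1) (hz : ‖z‖ < 1) : ‖discAut a z‖ < 1 := by
  have hd := discAut_denom_ne_zero ha hz
  rw [discAut, norm_div, div_lt_one (norm_pos_iff.2 hd)]
  refine lt_of_pow_lt_pow_left₀ 2 (norm_nonneg _) ?_
  have h1 : ‖1 - starRingEnd ℂ a * z‖ ^ 2 - ‖z - a‖ ^ 2 = (1 - ‖a‖ ^ 2) * (1 - ‖z‖ ^ 2) := by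
    simp only [← Complex.normSq_eq_norm_sq, Complex.normSq_apply]
    simp
    ring
  have h2 : 0 < (1 - ‖a‖ ^ 2) * (1 - ‖z‖ ^ 2) := by
    apply mul_pos <;> nlinarith [norm_nonneg a, norm_nonneg z]
  linarith

theorem mapsTo_discAut {a : ℂ} (ha : ‖a‖ < 1) : MapsTo (discAut a) (ball 0 1) (ball 0 1) := by
  intro z hz
  simpa using norm_discAut_lt_one ha (by simpa using hz)

@[simp] theorem discAut_self (a : ℂ) : discAut a a = 0 := by simp [discAut]

@[simp] theorem discAut_neg_zero (a : ℂ) : discAut (-a) 0 = a := by simp [discAut]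

theorem discAut_neg_discAut {a z : ℂ} (ha : ‖a‖ < 1) (hz : ‖z‖ < 1) :
    discAut (-a) (discAut a z) = z := by
  have hd := discAut_denom_ne_zero ha hz
  have hd2 := discAut_denom_ne_zero (a := -a) (by simpa using ha) (norm_discAut_lt_one ha hz)
  rw [discAut, div_eq_iff hd2, map_neg]
  have h1 : discAut a z * (1 - starRingEnd ℂ a * z) = z - a := div_mul_cancel₀ _ hd
  linear_combination h1

theorem leftInvOn_discAut {a : ℂ} (ha : ‖a‖ < 1) :
    LeftInvOn (discAut (-a)) (discAut a) (ball 0 1) :=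
  fun _ hz ↦ discAut_neg_discAut ha (by simpa using hz)

theorem hasDerivAt_discAut {a z : ℂ} (ha : ‖a‖ < 1) (hz : ‖z‖ < 1) :
    HasDerivAt (discAut a) ((1 - ‖a‖ ^ 2) / (1 - starRingEnd ℂ a * z) ^ 2) z := by
  have hd := discAut_denom_ne_zero ha hz
  have h1 : HasDerivAt (fun z ↦ z - a) 1 z := (hasDerivAt_id z).sub_const a
  have h2 : HasDerivAt (fun z ↦ 1 - starRingEnd ℂ a * z) (-starRingEnd ℂ a) z := by
    simpa using ((hasDerivAt_id z).const_mul (starRingEnd ℂ a)).const_sub 1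
  refine (h1.div h2 hd).congr_deriv ?_
  congr 1
  rw [← Complex.conj_mul']
  ring

theorem differentiableOn_discAut {a : ℂ} (ha : ‖a‖ < 1) :
    DifferentiableOn ℂ (discAut a) (ball 0 1) :=
  fun _ hz ↦ (hasDerivAt_discAut ha (by simpa using hz)).differentiableAt.differentiableWithinAt

theorem deriv_discAut_self {a : ℂ} (ha : ‖a‖ < 1) :
    deriv (discAut a) a = (1 - (‖a‖ : ℂ) ^ 2)⁻¹ := by
  rw [(hasDerivAt_discAut ha ha).deriv, Complex.conj_mul']
  have : (1 - (‖a‖ : ℂ) ^ 2) ≠ 0 := by exact_mod_cast one_sub_normSq_ne_zero ha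
  field_simp

theorem norm_one_sub_normSq {a : ℂ} (ha : ‖a‖ < 1) : ‖(1 - (‖a‖ : ℂ) ^ 2)‖ = 1 - ‖a‖ ^ 2 := by
  have h : (1 - (‖a‖ : ℂ) ^ 2) = ((1 - ‖a‖ ^ 2 : ℝ) : ℂ) := by push_cast; ring
  rw [h, Complex.norm_real, Real.norm_of_nonneg]
  nlinarith [norm_nonneg a]

end Moebius

/-! ### Logarithmic area and circular means -/

section LogArea

/-- The open round annulus `a < |z| < b`. -/
def annulus (a b : ℝ) : Set ℂ := {z | a < ‖z‖ ∧ ‖z‖ < b}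

theorem isOpen_annulus (a b : ℝ) : IsOpen (annulus a b) :=
  (isOpen_lt continuous_const continuous_norm).inter (isOpen_lt continuous_norm continuous_const)

theorem setLIntegral_annulus {a b : ℝ} (ha : 0 ≤ a) {g : ℂ → ℝ≥0∞} (hg : Measurable g) :
    ∫⁻ z in annulus a b, g z =
      ∫⁻ r in Ioo a b, ENNReal.ofReal r * ∫⁻ θ in Ioo (-Real.pi) Real.pi, g (circleMap 0 r θ) := by
  have hA := (isOpen_annulus a b).measurableSet
  have hcm : Measurable fun p : ℝ × ℝ ↦ circleMap 0 p.1 p.2 := by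
    unfold circleMap; fun_prop
  have hm : Measurable fun p : ℝ × ℝ ↦
      ENNReal.ofReal p.1 * (annulus a b).indicator g (circleMap 0 p.1 p.2) :=
    (ENNReal.measurable_ofReal.comp measurable_fst).mul ((hg.indicator hA).comp hcm)
  rw [← lintegral_indicator hA, ← Complex.lintegral_comp_polarCoord_symm]
  have h1 : ∀ p : ℝ × ℝ, Complex.polarCoord.symm p = circleMap 0 p.1 p.2 := by
    intro p
    rw [Complex.polarCoord_symm_apply, circleMap, Complex.exp_mul_I]
    push_cast
    ring
  simp_rw [h1, smul_eq_mul]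
  rw [polarCoord_target, Measure.volume_eq_prod, ← Measure.prod_restrict,
    lintegral_prod _ hm.aemeasurable, ← lintegral_indicator measurableSet_Ioi,
    ← lintegral_indicator measurableSet_Ioo]
  congr 1
  ext r
  by_cases hr : 0 < r
  · rw [indicator_of_mem (show r ∈ Ioi 0 from hr)]
    dsimp only
    rw [lintegral_const_mul' _ _ ENNReal.ofReal_ne_top]
    by_cases hab : r ∈ Ioo a b
    · rw [indicator_of_mem hab]
      congr 1
      refine lintegral_congr fun θ ↦ indicator_of_mem ?_ _
      simpa [annulus, abs_of_pos hr] using hab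
    · rw [indicator_of_notMem hab]
      convert mul_zero _
      rw [← lintegral_zero (μ := volume.restrict (Ioo (-Real.pi) Real.pi))]
      refine lintegral_congr fun θ ↦ indicator_of_notMem ?_ _
      simpa [annulus, abs_of_pos hr] using hab
  · rw [indicator_of_notMem (show r ∉ Ioi 0 from hr), indicator_of_notMem]
    exact fun h ↦ hr (ha.trans_lt h.1)

theorem setLIntegral_inv_Ioo {a b : ℝ} (ha : 0 < a) (hab : a ≤ b) {c : ℝ} (hc : 0 ≤ c) :
    ∫⁻ r in Ioo a b, ENNReal.ofReal (c * r⁻¹) = ENNReal.ofReal (c * Real.log (b / a)) := by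
  rw [← integral_inv_of_pos ha (ha.trans_le hab), ← intervalIntegral.integral_const_mul,
    intervalIntegral.integral_of_le hab, integral_Ioc_eq_integral_Ioo,
    ofReal_integral_eq_lintegral_ofReal]
  · refine IntegrableOn.mono_set (t := Icc a b) (ContinuousOn.integrableOn_Icc ?_) Ioo_subset_Icc_self
    exact continuousOn_const.mul (continuousOn_inv₀.mono fun x hx ↦ (ha.trans_le hx.1).ne')
  · filter_upwards [ae_restrict_mem measurableSet_Ioo] with r hr
    have := ha.trans hr.1
    positivity

/-- The density of the logarithmic area. -/
noncomputable def logDensity (w : ℂ) : ℝ≥0∞ := ENNReal.ofReal ((‖w‖ ^ 2)⁻¹)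

theorem measurable_logDensity : Measurable logDensity := by
  unfold logDensity; fun_prop

theorem lintegral_logDensity_annulus {a b : ℝ} (ha : 0 < a) (hab : a ≤ b) :
    ∫⁻ z in annulus a b, logDensity z = ENNReal.ofReal (2 * Real.pi * Real.log (b / a)) := by
  rw [setLIntegral_annulus ha.le measurable_logDensity, ← setLIntegral_inv_Ioo ha hab (by positivity)]
  refine setLIntegral_congr_fun measurableSet_Ioo fun r hr ↦ ?_
  have hr0 : 0 < r := ha.trans hr.1
  simp only [logDensity, norm_circleMap_zero, lintegral_const, Measure.restrict_apply_univ,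
    Real.volume_Ioo]
  rw [← ENNReal.ofReal_mul (by positivity), ← ENNReal.ofReal_mul (by positivity), sq_abs]
  congr 1
  field_simp
  ring

/-- Change of variables: multiplication by `f'`, as a real linear map, has determinant `|f'|²`. -/
theorem setLIntegral_image_of_injOn {f : ℂ → ℂ} {U : Set ℂ} (hU : IsOpen U)
    (hf : DifferentiableOn ℂ f U) (hinj : InjOn f U) (g : ℂ → ℝ≥0∞) :
    ∫⁻ w in f '' U, g w = ∫⁻ z in U, ENNReal.ofReal (‖deriv f z‖ ^ 2) * g (f z) := by
  rw [lintegral_image_eq_lintegral_abs_det_fderiv_mul volume hU.measurableSet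
    (f' := fun z ↦ (ContinuousLinearMap.toSpanSingleton ℂ (deriv f z)).restrictScalars ℝ) ?_ hinj]
  · refine lintegral_congr fun z ↦ ?_
    congr 2
    have : (ContinuousLinearMap.toSpanSingleton ℂ (deriv f z)).det = deriv f z := by
      simp [ContinuousLinearMap.det]
    simp [ContinuousLinearMap.det, LinearMap.det_restrictScalars, Algebra.norm_complex_eq,
      Complex.normSq_eq_norm_sq]
  · intro z hz
    exact (hf.differentiableAt (hU.mem_nhds hz)).hasDerivAt.hasFDerivAt.restrictScalars ℝ
      |>.hasFDerivWithinAt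

/-- In the coordinate `log z` inversion is `u ↦ -u`, which preserves area. -/
theorem setLIntegral_logDensity_image_inv {E : Set ℂ} (hE : IsOpen E) (h0 : (0 : ℂ) ∉ E) :
    ∫⁻ w in (fun z : ℂ ↦ z⁻¹) '' E, logDensity w = ∫⁻ w in E, logDensity w := by
  have hne : ∀ z ∈ E, z ≠ 0 := fun z hz h ↦ h0 (h ▸ hz)
  rw [setLIntegral_image_of_injOn hE
    (fun z hz ↦ (differentiableAt_inv (hne z hz)).differentiableWithinAt)
    (inv_injective.injOn)]
  refine setLIntegral_congr_fun hE.measurableSet fun z hz ↦ ?_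
  have hz0 : 0 < ‖z‖ := norm_pos_iff.2 (hne z hz)
  simp only [logDensity, deriv_inv]
  rw [← ENNReal.ofReal_mul (by positivity)]
  congr 1
  simp
  field_simp

/-- The mean value property gives `∫ Re H = 2π`, and `|H|² ≥ 2 Re H - 1` pointwise. -/
theorem lintegral_circle_ge {H : ℂ → ℂ} (hH : DifferentiableOn ℂ H (ball 0 1)) (h0 : H 0 = 1)
    {r : ℝ} (hr0 : 0 < r) (hr1 : r < 1) :
    ENNReal.ofReal (2 * Real.pi) ≤
      ∫⁻ θ in Ioo (-Real.pi) Real.pi, ENNReal.ofReal (‖H (circleMap 0 r θ)‖ ^ 2) := by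
  have hmem : ∀ θ, circleMap 0 r θ ∈ ball (0 : ℂ) 1 := fun θ ↦ by simp [abs_of_pos hr0, hr1]
  have hc : Continuous fun θ ↦ H (circleMap 0 r θ) :=
    hH.continuousOn.comp_continuous (continuous_circleMap 0 r) hmem
  have hav : Real.circleAverage H 0 r = H 0 := by
    refine DiffContOnCl.circleAverage (DifferentiableOn.diffContOnCl (hH.mono ?_))
    rw [abs_of_pos hr0]
    exact closure_ball_subset_closedBall.trans (closedBall_subset_ball hr1)
  have hint : ∫ θ in (-Real.pi)..Real.pi, H (circleMap 0 r θ) = 2 * Real.pi := by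
    rw [Real.circleAverage_def, h0] at hav
    have hper : Function.Periodic (fun θ ↦ H (circleMap 0 r θ)) (2 * Real.pi) := fun θ ↦ by
      simp only [periodic_circleMap 0 r θ]
    have h1 := hper.intervalIntegral_add_eq (-Real.pi) 0
    rw [show -Real.pi + 2 * Real.pi = Real.pi by ring, zero_add] at h1
    rw [h1]
    have hpi : (2 * Real.pi : ℝ) ≠ 0 := by positivity
    rw [inv_smul_eq_iff₀ hpi] at hav
    rw [hav]
    simp
  have hre : ∫ θ in (-Real.pi)..Real.pi, (H (circleMap 0 r θ)).re = 2 * Real.pi := by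
    have h1 := Complex.reCLM.intervalIntegral_comp_comm
      (hc.intervalIntegrable (μ := volume) (-Real.pi) Real.pi)
    rw [hint] at h1
    simpa using h1
  have hle : -Real.pi ≤ Real.pi := by linarith [Real.pi_pos]
  have hc2 : Continuous fun θ ↦ ‖H (circleMap 0 r θ)‖ ^ 2 := hc.norm.pow 2
  have hc3 : Continuous fun θ ↦ 2 * (H (circleMap 0 r θ)).re - 1 :=
    (continuous_const.mul (Complex.continuous_re.comp hc)).sub continuous_const
  have hge : 2 * Real.pi ≤ ∫ θ in (-Real.pi)..Real.pi, ‖H (circleMap 0 r θ)‖ ^ 2 := by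
    calc 2 * Real.pi = ∫ θ in (-Real.pi)..Real.pi, (2 * (H (circleMap 0 r θ)).re - 1) := by
          rw [intervalIntegral.integral_sub, intervalIntegral.integral_const_mul, hre]
          · simp; ring
          · exact (continuous_const.mul (Complex.continuous_re.comp hc)).intervalIntegrable _ _
          · exact continuous_const.intervalIntegrable _ _
      _ ≤ _ := by
          refine intervalIntegral.integral_mono_on hle (hc3.intervalIntegrable _ _)
            (hc2.intervalIntegrable _ _) fun θ _ ↦ ?_
          rw [← Complex.normSq_eq_norm_sq, Complex.normSq_apply]
          nlinarith [sq_nonneg ((H (circleMap 0 r θ)).re - 1), sq_nonneg (H (circleMap 0 r θ)).im]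
  refine (ENNReal.ofReal_le_ofReal hge).trans ?_
  rw [intervalIntegral.integral_of_le hle, integral_Ioc_eq_integral_Ioo,
    ofReal_integral_eq_lintegral_ofReal]
  · exact hc2.integrableOn_Icc.mono_set Ioo_subset_Icc_self
  · exact ae_of_all _ fun θ ↦ by positivity

end LogArea

/-! ### Koebe quarter theorem and Schwarz lemmas -/

section Koebe

theorem isSimplyConnected_ball (c : ℂ) {r : ℝ} (hr : 0 < r) : IsSimplyConnected (ball c r) := by
  have := (convex_ball c r).contractibleSpace (nonempty_ball.2 hr)
  exact inferInstanceAs (SimplyConnectedSpace (ball c r))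

/-- A continuous root exists by simple connectedness. It is holomorphic because its difference
quotient is that of `g` divided by `h w + h z`, which tends to `2 h z ≠ 0`. -/
theorem exists_differentiableOn_sq_eq {U : Set ℂ} (hUo : IsOpen U) (hUc : IsSimplyConnected U)
    {g : ℂ → ℂ} (hg : DifferentiableOn ℂ g U) (h0 : ∀ z ∈ U, g z ≠ 0) :
    ∃ h : ℂ → ℂ, DifferentiableOn ℂ h U ∧ ∀ z, h z ^ 2 = g z := by
  obtain ⟨h, hc, hsq⟩ := Complex.exists_continuousOn_pow_eq hUc hUo hg.continuousOn
    (by rintro ⟨z, hz, hz0⟩; exact h0 z hz hz0) two_ne_zero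
  refine ⟨h, fun z hz ↦ ?_, hsq⟩
  have hhz : h z ≠ 0 := fun hh ↦ h0 z hz (by rw [← hsq, hh]; simp)
  have hcz : ContinuousAt h z := hc.continuousAt (hUo.mem_nhds hz)
  have hsum : Tendsto (fun w ↦ h w + h z) (𝓝 z) (𝓝 (h z + h z)) := hcz.add_const _
  have hne : h z + h z ≠ 0 := by simpa [← two_mul] using hhz
  have hsl := hasDerivAt_iff_tendsto_slope.1 (hg.differentiableAt (hUo.mem_nhds hz)).hasDerivAt
  refine (hasDerivAt_iff_tendsto_slope.2 ((hsl.div (hsum.mono_left nhdsWithin_le_nhds) hne).congr'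
    ?_)).differentiableAt.differentiableWithinAt
  filter_upwards [nhdsWithin_le_nhds (hsum.eventually_ne hne)] with w hw
  simp only [Pi.div_apply, slope_def_field, ← hsq]
  rw [div_eq_iff hw]
  ring

/-- The derivative at the origin of a univalent Bieberbach-Eilenberg function. -/
theorem norm_deriv_le_one_of_mul_ne_one {w : ℂ → ℂ} (hw : DifferentiableOn ℂ w (ball 0 1))
    (hinj : InjOn w (ball 0 1)) (h0 : w 0 = 0)
    (hBE : ∀ a ∈ ball (0 : ℂ) 1, ∀ b ∈ ball (0 : ℂ) 1, w a * w b ≠ 1) : ‖deriv w 0‖ ≤ 1 := by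
  by_contra! hc
  -- Near the origin `w` expands by at least `d > 1`. This shrinks the annulus available to the
  -- image of `s < |z| < 1` and its reflection, until their logarithmic areas no longer fit.
  obtain ⟨d, hd1, hdc⟩ := exists_between hc
  have hd0 : 0 < d := by linarith
  have hz0 : (0 : ℂ) ∈ ball (0 : ℂ) 1 := by simp
  have hc0 : deriv w 0 ≠ 0 := norm_pos_iff.1 (by linarith)
  set ψ := Function.invFunOn w (ball 0 1)
  have hψ : LeftInvOn ψ w (ball 0 1) := hinj.leftInvOn_invFunOn
  have hopen := isOpen_image_of_injOn isOpen_ball hw hinj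
  have h0im : (0 : ℂ) ∈ w '' ball 0 1 := ⟨0, hz0, h0⟩
  have hψ0 : ψ 0 = 0 := by rw [← h0, hψ hz0, h0]
  have hψd : HasDerivAt ψ (deriv w 0)⁻¹ 0 := by
    have h1 := ((differentiableOn_of_leftInvOn isOpen_ball hw hψ).differentiableAt
      (hopen.mem_nhds h0im)).hasDerivAt
    have h2 := deriv_mul_deriv_of_leftInvOn isOpen_ball hw hψ hz0
    rw [h0] at h2
    rwa [eq_inv_of_mul_eq_one_left h2] at h1
  have hψle : ∀ᶠ y in 𝓝 (0 : ℂ), ‖ψ y‖ ≤ d⁻¹ * ‖y‖ := by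
    have hlt : ‖(deriv w 0)⁻¹‖ < d⁻¹ := by
      rw [norm_inv]; exact inv_strictAnti₀ hd0 hdc
    have h1 := (hasDerivAt_iff_tendsto_slope.1 hψd).norm.eventually_lt_const hlt
    rw [eventually_nhdsWithin_iff] at h1
    filter_upwards [h1] with y hy
    rcases eq_or_ne y 0 with rfl | hne
    · simp [hψ0]
    · have h2 := hy hne
      rw [slope_def_field, hψ0, sub_zero, sub_zero, norm_div,
        div_lt_iff₀ (norm_pos_iff.2 hne)] at h2
      exact h2.le
  obtain ⟨η, hη, hball⟩ := Metric.mem_nhds_iff.1 (inter_mem (hopen.mem_nhds h0im) hψle)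
  have hlow : ∀ z ∈ ball (0 : ℂ) 1, ‖w z‖ < η → d * ‖z‖ ≤ ‖w z‖ := by
    intro z hz hzη
    have := (hball (show w z ∈ ball 0 η by simpa using hzη)).2
    simp only [mem_ofPred_eq, hψ hz] at this
    rwa [← div_eq_inv_mul, le_div_iff₀' hd0] at this
  -- The image contains the disk of radius `η`, so a value of modulus above `η⁻¹` would have its
  -- reciprocal in the image.
  have hup : ∀ z ∈ ball (0 : ℂ) 1, ‖w z‖ ≤ η⁻¹ := by
    intro z hz
    by_contra! hlt
    have hpos : 0 < ‖w z‖ := (inv_pos.2 hη).trans hlt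
    obtain ⟨b, hb, hbe⟩ := (hball (show (w z)⁻¹ ∈ ball 0 η by
      simpa using (inv_lt_comm₀ hη hpos).1 hlt)).1
    exact hBE z hz b hb (by rw [hbe]; exact mul_inv_cancel₀ (norm_pos_iff.1 hpos))
  -- The inner radius is chosen so that `m = d * s` is below both `η` and `1`: then `hlow` and `hup`
  -- confine the image to `m < |y| < m⁻¹`.
  obtain ⟨s, hs0, hs⟩ : ∃ s, 0 < s ∧ s < min (η / d) d⁻¹ := exists_between (by positivity)
  have hsη : d * s < η := by
    have := hs.trans_le (min_le_left _ _)
    rwa [lt_div_iff₀' hd0] at this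
  have hds1 : d * s < 1 := by
    have := hs.trans_le (min_le_right _ _)
    rwa [← one_div, lt_div_iff₀' hd0] at this
  have hs1 : s < 1 := by nlinarith
  set m := d * s
  have hm : 0 < m := by positivity
  set A := annulus s 1
  have hA1 : A ⊆ ball 0 1 := fun z hz ↦ by simpa using hz.2
  have hE : IsOpen (w '' A) :=
    isOpen_image_of_injOn (isOpen_annulus _ _) (hw.mono hA1) (hinj.mono hA1)
  have hEK : w '' A ⊆ annulus m m⁻¹ := by
    rintro _ ⟨z, hz, rfl⟩
    refine ⟨?_, (hup z (hA1 hz)).trans_lt (inv_strictAnti₀ hm hsη)⟩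
    by_contra! hle
    have h1 := hlow z (hA1 hz) (hle.trans_lt hsη)
    have h2 := mul_lt_mul_of_pos_left hz.1 hd0
    linarith
  have hE0 : (0 : ℂ) ∉ w '' A := fun h ↦ by simpa using hm.trans (hEK h).1
  have hEiK : (fun z : ℂ ↦ z⁻¹) '' (w '' A) ⊆ annulus m m⁻¹ := by
    rintro _ ⟨y, hy, rfl⟩
    obtain ⟨h1, h2⟩ := hEK hy
    have hy0 := hm.trans h1
    refine ⟨?_, ?_⟩
    · simpa using (lt_inv_comm₀ hy0 hm).1 h2
    · simpa using inv_strictAnti₀ hm h1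
  have hdisj : Disjoint (w '' A) ((fun z : ℂ ↦ z⁻¹) '' (w '' A)) := by
    rw [Set.disjoint_left]
    rintro y ⟨a, ha, rfl⟩ ⟨_, ⟨b, hb, rfl⟩, hab⟩
    refine hBE a (hA1 ha) b (hA1 hb) ?_
    rw [← show (w b)⁻¹ = w a from hab]
    exact inv_mul_cancel₀ fun h ↦ hE0 ⟨b, hb, h⟩
  have harea : 2 * ∫⁻ y in w '' A, logDensity y ≤
      ENNReal.ofReal (2 * Real.pi * Real.log (m⁻¹ / m)) := by
    rw [← lintegral_logDensity_annulus hm (by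
      exact (hds1.le).trans ((one_le_inv₀ hm).2 hds1.le)), two_mul]
    nth_rw 2 [← setLIntegral_logDensity_image_inv hE hE0]
    rw [← lintegral_union _ hdisj]
    · exact lintegral_mono_set (union_subset hEK hEiK)
    · rw [show (fun z : ℂ ↦ z⁻¹) '' (w '' A) = (fun z : ℂ ↦ z⁻¹) ⁻¹' (w '' A) from
        congrFun (Set.image_eq_preimage_of_inverse inv_inv inv_inv) _]
      exact measurable_inv hE.measurableSet
  -- Here `q = w / z` and `H = z w' / w`, with singularities at `0` removed and `H 0 = 1`. The
  -- logarithmic area of the image is the integral of `|H|² / |z|²` over the annulus.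
  set q := dslope w 0
  have hq : DifferentiableOn ℂ q (ball 0 1) :=
    (Complex.differentiableOn_dslope (isOpen_ball.mem_nhds hz0)).2 hw
  have hzq : ∀ z, z * q z = w z := fun z ↦ by
    have := sub_smul_dslope w 0 z
    simpa [h0] using this
  have hq0 : ∀ z ∈ ball (0 : ℂ) 1, q z ≠ 0 := by
    intro z hz hqz
    rcases eq_or_ne z 0 with rfl | hne
    · exact hc0 (by rw [← dslope_same]; exact hqz)
    · have h1 := hzq z
      rw [hqz, mul_zero, ← h0] at h1
      exact hne (hinj hz hz0 h1.symm)
  set H := fun z ↦ deriv w z / q z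
  have hH : DifferentiableOn ℂ H (ball 0 1) := (hw.deriv isOpen_ball).div hq hq0
  have hH0 : H 0 = 1 := by
    simp only [H, q, dslope_same]
    exact div_self hc0
  classical
  -- Cutting off outside `A` makes the integrand measurable on the whole plane, as polar coordinates
  -- require.
  set g : ℂ → ℝ≥0∞ := A.piecewise (fun z ↦ ENNReal.ofReal (‖H z‖ ^ 2 * (‖z‖ ^ 2)⁻¹)) 0
  have hAz : ∀ z ∈ A, z ≠ 0 := by
    rintro z hz rfl
    exact hs0.not_gt (by simpa using hz.1)
  have hg : Measurable g := by
    refine ContinuousOn.measurable_piecewise ?_ continuousOn_const (isOpen_annulus _ _).measurableSet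
    refine ENNReal.continuous_ofReal.comp_continuousOn ?_
    refine ((hH.continuousOn.mono hA1).norm.pow 2).mul (ContinuousOn.inv₀ (by fun_prop) ?_)
    intro z hz
    simpa using hAz z hz
  have hint : ∫⁻ y in w '' A, logDensity y = ∫⁻ z in A, g z := by
    rw [setLIntegral_image_of_injOn (isOpen_annulus _ _) (hw.mono hA1) (hinj.mono hA1)]
    refine setLIntegral_congr_fun (isOpen_annulus _ _).measurableSet fun z hz ↦ ?_
    rw [show g z = _ from piecewise_eq_of_mem A _ _ hz]
    simp only [logDensity]
    rw [← ENNReal.ofReal_mul (by positivity)]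
    congr 1
    rw [← hzq z]
    simp only [H, norm_div, norm_mul]
    have := norm_pos_iff.2 (hAz z hz)
    have := norm_pos_iff.2 (hq0 z (hA1 hz))
    field_simp
  have hlower : ENNReal.ofReal (2 * Real.pi * Real.log (1 / s)) ≤ ∫⁻ y in w '' A, logDensity y := by
    rw [hint, setLIntegral_annulus hs0.le hg, ← setLIntegral_inv_Ioo hs0 hs1.le (by positivity)]
    refine setLIntegral_mono' measurableSet_Ioo fun r hr ↦ ?_
    have hr0 : 0 < r := hs0.trans hr.1
    have h1 : ∀ θ, g (circleMap 0 r θ) =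
        ENNReal.ofReal ((r ^ 2)⁻¹) * ENNReal.ofReal (‖H (circleMap 0 r θ)‖ ^ 2) := by
      intro θ
      have hmem : circleMap 0 r θ ∈ A := by
        simpa [A, annulus, abs_of_pos hr0] using hr
      simp only [g, piecewise_eq_of_mem _ _ _ hmem]
      rw [mul_comm, ENNReal.ofReal_mul (by positivity)]
      simp
    simp_rw [h1]
    rw [lintegral_const_mul' _ _ ENNReal.ofReal_ne_top, ← mul_assoc,
      ← ENNReal.ofReal_mul hr0.le]
    calc ENNReal.ofReal (2 * Real.pi * r⁻¹)
        = ENNReal.ofReal (r * (r ^ 2)⁻¹) * ENNReal.ofReal (2 * Real.pi) := by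
          rw [← ENNReal.ofReal_mul (by positivity)]
          congr 1
          field_simp
      _ ≤ _ := by gcongr; exact lintegral_circle_ge hH hH0 hr0 hr.2
  have hfin : 2 * ENNReal.ofReal (2 * Real.pi * Real.log (1 / s)) ≤
      ENNReal.ofReal (2 * Real.pi * Real.log (m⁻¹ / m)) :=
    (mul_le_mul_right hlower 2).trans harea
  have hlogs : 0 < Real.log (1 / s) := Real.log_pos (by rw [one_div]; exact (one_lt_inv₀ hs0).2 hs1)
  have hlogm : Real.log (m⁻¹ / m) = 2 * (Real.log (1 / s) - Real.log d) := by
    simp only [m]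
    rw [div_eq_mul_inv, ← sq, Real.log_pow, Real.log_inv, Real.log_mul hd0.ne' hs0.ne', one_div,
      Real.log_inv]
    push_cast
    ring
  rw [← ENNReal.ofReal_ofNat, ← ENNReal.ofReal_mul (by positivity), hlogm] at hfin
  have hlogd : 0 < Real.log d := Real.log_pos hd1
  have hpi := Real.pi_pos
  -- `ENNReal.ofReal` truncates at zero, so the sign is settled first. In real numbers the
  -- inequality would give `log (1/s) ≤ log (1/s) - log d`, against `d > 1`.
  rcases le_or_gt (2 * Real.pi * (2 * (Real.log (1 / s) - Real.log d))) 0 with hneg | hpos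
  · rw [ENNReal.ofReal_of_nonpos hneg] at hfin
    have := ENNReal.ofReal_eq_zero.1 (le_antisymm hfin zero_le)
    have : 0 < 2 * (2 * Real.pi * Real.log (1 / s)) := by positivity
    linarith
  · have := (ENNReal.ofReal_le_ofReal_iff hpos.le).1 hfin
    nlinarith

/-- The Koebe quarter theorem: a univalent function in the unit disk omits no value close to its
value at the centre. -/
theorem norm_deriv_zero_le_of_notMem_image {f : ℂ → ℂ} (hf : DifferentiableOn ℂ f (ball 0 1))
    (hinj : InjOn f (ball 0 1)) {a : ℂ} (ha : a ∉ f '' ball 0 1) :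
    ‖deriv f 0‖ ≤ 4 * ‖f 0 - a‖ := by
  have hz0 : (0 : ℂ) ∈ ball (0 : ℂ) 1 := by simp
  have hne : ∀ z ∈ ball (0 : ℂ) 1, f z - a ≠ 0 := fun z hz h ↦ ha ⟨z, hz, sub_eq_zero.1 h⟩
  obtain ⟨g, hg, hsq⟩ := exists_differentiableOn_sq_eq isOpen_ball
    (isSimplyConnected_ball 0 one_pos) (hf.sub_const a) hne
  have hg0 : ∀ z ∈ ball (0 : ℂ) 1, g z ≠ 0 := fun z hz h ↦ hne z hz (by rw [← hsq, h]; simp)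
  have hsum : ∀ x ∈ ball (0 : ℂ) 1, ∀ y ∈ ball (0 : ℂ) 1, g x + g y ≠ 0 := by
    intro x hx y hy h
    have h1 : f x = f y := by
      have := hsq x
      rw [eq_neg_of_add_eq_zero_left h, neg_sq, hsq y] at this
      linear_combination -this
    obtain rfl := hinj hx hy h1
    exact hg0 x hx (by simpa [← two_mul] using h)
  have hginj : InjOn g (ball 0 1) := by
    intro x hx y hy h
    refine hinj hx hy ?_
    have := hsq x
    rw [h, hsq y] at this
    linear_combination -this
  set c := g 0
  have hc : c ≠ 0 := hg0 0 hz0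
  -- The root `g` never takes two opposite values. The Moebius map sending `c` to `0` turns `y ↦ -y`
  -- into inversion, so this becomes `w x * w y ≠ 1`.
  set w := fun z ↦ (g z - c) / (g z + c)
  have hw : DifferentiableOn ℂ w (ball 0 1) :=
    (hg.sub_const c).div (hg.add_const c) fun z hz ↦ hsum z hz 0 hz0
  have hgd : HasDerivAt g (deriv g 0) 0 :=
    (hg.differentiableAt (isOpen_ball.mem_nhds hz0)).hasDerivAt
  have hwd : deriv w 0 = deriv g 0 / (2 * c) := by
    have h1 : HasDerivAt w _ 0 := (hgd.sub_const c).div (hgd.add_const c) (hsum 0 hz0 0 hz0)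
    rw [h1.deriv]
    have : g 0 = c := rfl
    rw [this]
    field_simp
    ring
  have hfd : deriv f 0 = 2 * c * deriv g 0 := by
    have h1 : HasDerivAt (fun z ↦ g z ^ 2 + a) (2 * c * deriv g 0) 0 := by
      simpa using (hgd.pow 2).add_const a
    refine (h1.congr_of_eventuallyEq (Eventually.of_forall fun z ↦ ?_)).deriv
    simp [hsq]
  have hle := norm_deriv_le_one_of_mul_ne_one hw ?_ (by simp [w, c]) ?_
  · rw [hwd, norm_div, div_le_one (by simpa using hc)] at hle
    rw [hfd, norm_mul, ← hsq 0, norm_pow]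
    calc ‖2 * c‖ * ‖deriv g 0‖ ≤ ‖2 * c‖ * ‖2 * c‖ := by gcongr
      _ = 4 * ‖g 0‖ ^ 2 := by simp [c]; ring
  · intro x hx y hy h
    refine hginj hx hy ?_
    simp only [w] at h
    rw [div_eq_div_iff (hsum x hx 0 hz0) (hsum y hy 0 hz0)] at h
    have : 2 * c * (g x - g y) = 0 := by linear_combination h
    simpa [hc, sub_eq_zero] using this
  · intro x hx y hy h
    simp only [w] at h
    rw [div_mul_div_comm, div_eq_one_iff_eq
      (mul_ne_zero (hsum x hx 0 hz0) (hsum y hy 0 hz0))] at h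
    have : 2 * c * (g x + g y) = 0 := by linear_combination -h
    rcases mul_eq_zero.1 this with h1 | h1
    · exact hc (by simpa using h1)
    · exact hsum x hx y hy h1

theorem deriv_comp_discAut {f : ℂ → ℂ} (hf : DifferentiableOn ℂ f (ball 0 1)) {ζ : ℂ}
    (hζ : ‖ζ‖ < 1) : deriv (f ∘ discAut (-ζ)) 0 = deriv f ζ * (1 - (‖ζ‖ : ℂ) ^ 2) := by
  have h1 := hasDerivAt_discAut (a := -ζ) (z := 0) (by simpa using hζ) (by simp)
  have h2 : HasDerivAt f (deriv f ζ) (discAut (-ζ) 0) := by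
    rw [discAut_neg_zero]
    exact (hf.differentiableAt (isOpen_ball.mem_nhds (by simpa using hζ))).hasDerivAt
  rw [(h2.comp 0 h1).deriv]
  simp

theorem image_discAut_neg_ball {ζ : ℂ} (hζ : ‖ζ‖ < 1) : discAut (-ζ) '' ball 0 1 = ball 0 1 := by
  have hn : ‖-ζ‖ < 1 := by simpa using hζ
  refine (mapsTo_discAut hn).image_subset.antisymm fun z hz ↦ ?_
  exact ⟨_, mapsTo_discAut hζ hz, leftInvOn_discAut hζ hz⟩

theorem injOn_discAut {a : ℂ} (ha : ‖a‖ < 1) : InjOn (discAut a) (ball 0 1) :=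
  (leftInvOn_discAut ha).injOn

theorem koebe_quarter {f : ℂ → ℂ} (hf : DifferentiableOn ℂ f (ball 0 1))
    (hinj : InjOn f (ball 0 1)) {a : ℂ} (ha : a ∉ f '' ball 0 1) {ζ : ℂ} (hζ : ‖ζ‖ < 1) :
    (1 - ‖ζ‖ ^ 2) * ‖deriv f ζ‖ ≤ 4 * ‖f ζ - a‖ := by
  have hn : ‖-ζ‖ < 1 := by simpa using hζ
  have h := norm_deriv_zero_le_of_notMem_image (f := f ∘ discAut (-ζ)) (a := a)
    (hf.comp (differentiableOn_discAut hn) (mapsTo_discAut hn))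
    (hinj.comp (injOn_discAut hn) (mapsTo_discAut hn))
    (by rwa [image_comp, image_discAut_neg_ball hζ])
  rw [deriv_comp_discAut hf hζ, norm_mul, norm_one_sub_normSq hζ] at h
  simpa [mul_comm] using h

/-- The Schwarz lemma for the inverse of a univalent function. -/
theorem radius_le_of_ball_subset_image {f : ℂ → ℂ} (hf : DifferentiableOn ℂ f (ball 0 1))
    (hinj : InjOn f (ball 0 1)) {ζ : ℂ} (hζ : ‖ζ‖ < 1) {r : ℝ} (hr : 0 < r)
    (hball : ball (f ζ) r ⊆ f '' ball 0 1) : r ≤ (1 - ‖ζ‖ ^ 2) * ‖deriv f ζ‖ := by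
  have hn : ‖-ζ‖ < 1 := by simpa using hζ
  set F := f ∘ discAut (-ζ)
  have hFd : DifferentiableOn ℂ F (ball 0 1) :=
    hf.comp (differentiableOn_discAut hn) (mapsTo_discAut hn)
  have hFi : InjOn F (ball 0 1) := hinj.comp (injOn_discAut hn) (mapsTo_discAut hn)
  have hFim : F '' ball 0 1 = f '' ball 0 1 := by
    rw [image_comp, image_discAut_neg_ball hζ]
  have hF0 : F 0 = f ζ := by simp [F]
  have hz0 : (0 : ℂ) ∈ ball (0 : ℂ) 1 := by simp
  set G := Function.invFunOn F (ball 0 1)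
  have hG : LeftInvOn G F (ball 0 1) := hFi.leftInvOn_invFunOn
  rw [← hFim, ← hF0] at hball
  have hGd := (differentiableOn_of_leftInvOn isOpen_ball hFd hG).mono hball
  have hG0 : G (F 0) = 0 := hG hz0
  -- The inverse `G` maps a disk of radius `r` into the unit disk and its centre to `0`, so `|G'| ≤
  -- 1 / r` at the centre.
  have hle := Complex.norm_deriv_le_div_of_mapsTo_ball (R₂ := 1) hGd (fun y hy ↦ by
    obtain ⟨x, hx, rfl⟩ := hball hy
    rw [hG0, hG hx]
    exact ball_subset_closedBall hx) hr
  have hmul := congrArg norm (deriv_mul_deriv_of_leftInvOn isOpen_ball hFd hG hz0)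
  rw [norm_mul, norm_one, deriv_comp_discAut hf hζ, norm_mul, norm_one_sub_normSq hζ] at hmul
  rw [le_div_iff₀ hr] at hle
  have hpos : 0 ≤ ‖deriv f ζ‖ * (1 - ‖ζ‖ ^ 2) :=
    mul_nonneg (norm_nonneg _) (by nlinarith [norm_nonneg ζ])
  calc r = ‖deriv G (F 0)‖ * r * (‖deriv f ζ‖ * (1 - ‖ζ‖ ^ 2)) := by linear_combination -r * hmul
    _ ≤ 1 * (‖deriv f ζ‖ * (1 - ‖ζ‖ ^ 2)) := by gcongr
    _ = _ := by ring

/-- The Schwarz-Pick inequality in the form `|f'(ζ)| (1 - |ζ|²) ≤ 1`. -/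
theorem norm_deriv_mul_le_one_of_mapsTo {f : ℂ → ℂ} (hf : DifferentiableOn ℂ f (ball 0 1))
    (hm : MapsTo f (ball 0 1) (ball 0 1)) {ζ : ℂ} (hζ : ‖ζ‖ < 1) :
    (1 - ‖ζ‖ ^ 2) * ‖deriv f ζ‖ ≤ 1 := by
  have hn : ‖-ζ‖ < 1 := by simpa using hζ
  have hb : ‖f ζ‖ < 1 := by simpa using hm (show ζ ∈ ball (0 : ℂ) 1 by simpa using hζ)
  set F := f ∘ discAut (-ζ)
  have hz0 : (0 : ℂ) ∈ ball (0 : ℂ) 1 := by simp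
  have hF0 : F 0 = f ζ := by simp [F]
  have hFd : DifferentiableOn ℂ F (ball 0 1) :=
    hf.comp (differentiableOn_discAut hn) (mapsTo_discAut hn)
  have hFm : MapsTo F (ball 0 1) (ball 0 1) := hm.comp (mapsTo_discAut hn)
  have hd := (differentiableOn_discAut hb).comp hFd hFm
  have hle := Complex.norm_deriv_le_one_of_mapsTo_ball hd (fun z hz ↦ by
    simpa [hF0] using (norm_discAut_lt_one hb (by simpa using hFm hz)).le) one_pos
  have hder : HasDerivAt (discAut (f ζ) ∘ F) ((1 - (‖f ζ‖ : ℂ) ^ 2)⁻¹ * deriv F 0) 0 := by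
    refine HasDerivAt.comp 0 ?_ (hFd.differentiableAt (isOpen_ball.mem_nhds hz0)).hasDerivAt
    rw [hF0, ← deriv_discAut_self hb]
    exact (hasDerivAt_discAut hb hb).differentiableAt.hasDerivAt
  rw [hder.deriv, norm_mul, norm_inv, norm_one_sub_normSq hb, deriv_comp_discAut hf hζ, norm_mul,
    norm_one_sub_normSq hζ] at hle
  have h1 : 0 < 1 - ‖f ζ‖ ^ 2 := by nlinarith [norm_nonneg (f ζ)]
  rw [inv_mul_le_iff₀ h1] at hle
  nlinarith [sq_nonneg ‖f ζ‖]

end Koebe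

/-! ### The Riemann mapping theorem -/

section RiemannMapping

variable {U : Set ℂ}

/-- A normal families argument: pointwise limits of holomorphic maps into the unit disk are locally
uniform limits. -/
theorem tendstoLocallyUniformlyOn_of_mapsTo_ball {ι : Type*} {φ : Filter ι} [φ.NeBot]
    (hU : IsOpen U) {F : ι → ℂ → ℂ} {g : ℂ → ℂ} (hF : ∀ n, DifferentiableOn ℂ (F n) U)
    (hm : ∀ n, MapsTo (F n) U (ball 0 1)) (hg : ∀ z ∈ U, Tendsto (F · z) φ (𝓝 (g z))) :
    TendstoLocallyUniformlyOn F g φ U := by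
  rw [Metric.tendstoLocallyUniformlyOn_iff]
  intro ε hε z hz
  obtain ⟨R, hR, hRU⟩ := Metric.isOpen_iff.1 hU z hz
  -- The Schwarz lemma gives one Lipschitz constant for all members of the family, since two values
  -- in the unit disk differ by less than `2`.
  have hlip : ∀ x ∈ ball z R, ∀ n, dist (F n x) (F n z) ≤ 2 / R * dist x z := by
    intro x hx n
    refine Complex.dist_le_div_mul_dist_of_mapsTo_ball ((hF n).mono hRU) (fun y hy ↦ ?_) hx
    have h1 := hm n (hRU hy)
    have h2 := hm n hz
    rw [mem_ball] at h1 h2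
    rw [mem_closedBall]
    linarith [dist_triangle_right (F n y) (F n z) 0]
  have hlim : ∀ x ∈ ball z R, dist (g x) (g z) ≤ 2 / R * dist x z := fun x hx ↦
    le_of_tendsto ((hg x (hRU hx)).dist (hg z hz)) (Eventually.of_forall fun n ↦ hlip x hx n)
  refine ⟨ball z (min R (R * ε / 8)), mem_nhdsWithin_of_mem_nhds (ball_mem_nhds _ (by positivity)),
    ?_⟩
  filter_upwards [(hg z hz).eventually (ball_mem_nhds _ (show 0 < ε / 4 by positivity))]
    with n hn x hx
  have hx1 : x ∈ ball z R := ball_subset_ball (min_le_left _ _) hx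
  have hx2 : 2 / R * dist x z ≤ ε / 4 := by
    have : dist x z < R * ε / 8 := lt_of_lt_of_le hx (min_le_right _ _)
    calc 2 / R * dist x z ≤ 2 / R * (R * ε / 8) := by gcongr
      _ = ε / 4 := by field_simp; norm_num
  have h1 := hlip x hx1 n
  have h2 := hlim x hx1
  have h3 : dist (F n z) (g z) < ε / 4 := hn
  calc dist (g x) (F n x) ≤ dist (g x) (g z) + dist (g z) (F n z) + dist (F n z) (F n x) :=
        dist_triangle4 _ _ _ _
    _ < ε := by
      rw [dist_comm (g z), dist_comm (F n z) (F n x)]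
      linarith

/-- Hurwitz's theorem on limits of univalent functions. -/
theorem injOn_of_tendstoLocallyUniformlyOn {ι : Type*} {φ : Filter ι} [φ.NeBot]
    (hU : IsOpen U) (hUc : IsPreconnected U) {F : ι → ℂ → ℂ} {g : ℂ → ℂ}
    (hF : ∀ n, DifferentiableOn ℂ (F n) U) (hinj : ∀ n, InjOn (F n) U)
    (hg : TendstoLocallyUniformlyOn F g φ U) {z₀ : ℂ} (hz₀ : z₀ ∈ U) (hd : deriv g z₀ ≠ 0) :
    InjOn g U := by
  have hgd : DifferentiableOn ℂ g U := hg.differentiableOn (Eventually.of_forall hF) hU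
  intro a ha b hb hab
  by_contra hne
  -- The hypothesis on `deriv g z₀` serves only to exclude a constant limit, so that `b` is an
  -- isolated point of its fibre.
  have hiso : ∀ᶠ z in 𝓝[≠] b, g z - g b ≠ 0 := by
    have han : AnalyticOnNhd ℂ (fun z ↦ g z - g b) U :=
      (hgd.sub_const _).analyticOnNhd hU
    refine (han b hb).eventually_eq_zero_or_eventually_ne_zero.resolve_left fun h ↦ hd ?_
    have hev := han.eqOn_zero_of_preconnected_of_eventuallyEq_zero hUc hb h
    have : g =ᶠ[𝓝 z₀] fun _ ↦ g b := by
      filter_upwards [hU.mem_nhds hz₀] with z hz using sub_eq_zero.1 (hev hz)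
    rw [this.deriv_eq, deriv_const]
  rw [eventually_nhdsWithin_iff] at hiso
  obtain ⟨r, hr, hball⟩ := Metric.nhds_basis_closedBall.mem_iff.1
    (inter_mem (inter_mem (hU.mem_nhds hb) hiso)
      (isOpen_compl_singleton.mem_nhds (show b ∈ {a}ᶜ from Ne.symm hne)))
  have hKU : closedBall b r ⊆ U := fun z hz ↦ (hball hz).1.1
  have hsph : ∀ z ∈ sphere b r, g z ≠ g b := fun z hz ↦ sub_ne_zero.1
    ((hball (sphere_subset_closedBall hz)).1.2 (ne_of_mem_sphere hz hr.ne'))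
  obtain ⟨ε, hε, hεs⟩ : ∃ ε > 0, ∀ z ∈ sphere b r, ε ≤ ‖g z - g b‖ := by
    obtain ⟨x, hx, hmin⟩ := (isCompact_sphere b r).exists_isMinOn
      (NormedSpace.sphere_nonempty.2 hr.le) (f := fun z ↦ ‖g z - g b‖)
      (((hgd.continuousOn.mono (sphere_subset_closedBall.trans hKU)).sub
        continuousOn_const).norm)
    exact ⟨_, norm_pos_iff.2 (sub_ne_zero.2 (hsph x hx)), fun z hz ↦ hmin hz⟩
  have hunif : TendstoUniformlyOn F g φ (closedBall b r) :=
    (tendstoLocallyUniformlyOn_iff_forall_isCompact hU).1 hg _ hKU (isCompact_closedBall b r)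
  have hpa : Tendsto (F · a) φ (𝓝 (g a)) := hg.tendsto_at ha
  have h4 : 0 < ε / 8 := by positivity
  obtain ⟨n, hn1, hn2⟩ := ((Metric.tendstoUniformlyOn_iff.1 hunif (ε / 8) h4).and
    (Metric.tendsto_nhds.1 hpa (ε / 8) h4)).exists
  have hbK : b ∈ closedBall b r := mem_closedBall_self hr.le
  have hsn : ∀ z ∈ sphere b r, ε / 2 ≤ ‖F n z - F n b‖ := by
    intro z hz
    have h1 := hn1 z (sphere_subset_closedBall hz)
    have h2 := hn1 b hbK
    have h3 := hεs z hz
    rw [← dist_eq_norm] at h3 ⊢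
    have := dist_triangle4 (g z) (F n z) (F n b) (g b)
    rw [dist_comm (F n b)] at this
    linarith
  have hfreq : ∃ᶠ z in 𝓝 b, F n z ≠ F n b := by
    refine Frequently.filter_mono (f := 𝓝[≠] b) (Eventually.frequently ?_) nhdsWithin_le_nhds
    rw [eventually_nhdsWithin_iff]
    filter_upwards [hU.mem_nhds hb] with z hz hzb h using hzb (hinj n hz hb h)
  -- Quantitative open mapping: `F n` takes on `closedBall b r` every value within `ε / 4` of `F n
  -- b`. The value `F n a` is one of these, but `a` lies outside that disk.
  have hsub := ((hF n).mono hKU).diffContOnCl_ball subset_rfl |>.ball_subset_image_closedBall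
    hr hsn hfreq
  have hmem : F n a ∈ ball (F n b) (ε / 2 / 2) := by
    have h2 := hn1 b hbK
    rw [mem_ball]
    have := dist_triangle (F n a) (g a) (F n b)
    rw [hab] at this hn2
    linarith
  obtain ⟨x, hx, hxa⟩ := hsub hmem
  exact (hball hx).2 (hinj n (hKU hx) ha hxa)

/-- The competitors in the extremal problem of the Riemann mapping theorem. -/
structure IsRiemannCompetitor (U : Set ℂ) (z₀ : ℂ) (f : ℂ → ℂ) : Prop where
  differentiableOn : DifferentiableOn ℂ f U
  injOn : InjOn f U
  mapsTo : MapsTo f U (ball 0 1)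
  map_base : f z₀ = 0

/-- For an omitted value `a`, a square root `h` of `z - a` takes no two opposite values. Its image
contains a disk about `h z₀`, hence misses the opposite disk, and `1 / (h + h z₀)` is bounded. -/
theorem exists_isRiemannCompetitor (hUo : IsOpen U) (hUc : IsSimplyConnected U) (hU : U ≠ univ)
    {z₀ : ℂ} (hz₀ : z₀ ∈ U) : ∃ f, IsRiemannCompetitor U z₀ f := by
  obtain ⟨a, ha⟩ := (ne_univ_iff_exists_notMem U).1 hU
  have hne : ∀ z ∈ U, z - a ≠ 0 := fun z hz h ↦ ha (sub_eq_zero.1 h ▸ hz)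
  obtain ⟨h, hd, hsq⟩ := exists_differentiableOn_sq_eq hUo hUc
    (differentiableOn_id.sub_const a) hne
  simp only [id] at hsq
  have hinj : InjOn h U := fun x _ y _ hxy ↦ by
    have := hsq x
    rw [hxy, hsq y] at this
    linear_combination -this
  obtain ⟨ε, hε, hball⟩ := Metric.isOpen_iff.1 (isOpen_image_of_injOn hUo hd hinj) (h z₀)
    ⟨z₀, hz₀, rfl⟩
  have hfar : ∀ z ∈ U, ε ≤ ‖h z + h z₀‖ := by
    intro z hz
    by_contra! hlt
    obtain ⟨y, hy, hyz⟩ := hball (show -h z ∈ ball (h z₀) ε by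
      rwa [mem_ball, dist_eq_norm, show -h z - h z₀ = -(h z + h z₀) by ring, norm_neg])
    have h1 := hsq y
    rw [hyz, neg_sq, hsq z] at h1
    have h2 : z = y := by linear_combination h1
    subst h2
    refine hne z hz ?_
    rw [← hsq, show h z = 0 by linear_combination hyz / 2]
    simp
  have hpos : ∀ z ∈ U, h z + h z₀ ≠ 0 := fun z hz ↦ norm_pos_iff.1 (hε.trans_le (hfar z hz))
  set k : ℂ → ℂ := fun z ↦ (ε / 2 : ℂ) / (h z + h z₀)
  have hkm : MapsTo k U (ball 0 1) := by
    intro z hz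
    rw [mem_ball_zero_iff, norm_div, div_lt_one (norm_pos_iff.2 (hpos z hz))]
    refine lt_of_lt_of_le ?_ (hfar z hz)
    simp [abs_of_pos hε, hε]
  have hk0 : ‖k z₀‖ < 1 := by simpa using hkm hz₀
  have hkd : DifferentiableOn ℂ k U :=
    (differentiableOn_const _).div (hd.add_const _) hpos
  have hki : InjOn k U := by
    intro x hx y hy hxy
    refine hinj hx hy ?_
    simp only [k] at hxy
    rw [div_eq_div_iff (hpos x hx) (hpos y hy)] at hxy
    have hε2 : (ε / 2 : ℂ) ≠ 0 := by
      simpa using hε.ne'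
    exact (add_right_cancel (mul_left_cancel₀ hε2 hxy)).symm
  exact ⟨discAut (k z₀) ∘ k, (differentiableOn_discAut hk0).comp hkd hkm,
    (injOn_discAut hk0).comp hki hkm, (mapsTo_discAut hk0).comp hkm, by simp⟩

/-- A competitor that is not onto the disk is not extremal (the Koebe square root trick). -/
theorem IsRiemannCompetitor.exists_norm_deriv_lt (hUo : IsOpen U) (hUc : IsSimplyConnected U)
    {z₀ : ℂ} (hz₀ : z₀ ∈ U) {f : ℂ → ℂ} (hf : IsRiemannCompetitor U z₀ f)
    {a : ℂ} (ha : ‖a‖ < 1) (haf : a ∉ f '' U) :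
    ∃ g, IsRiemannCompetitor U z₀ g ∧ ‖deriv f z₀‖ < ‖deriv g z₀‖ := by
  set k := discAut a ∘ f
  have hkd : DifferentiableOn ℂ k U := (differentiableOn_discAut ha).comp hf.differentiableOn hf.mapsTo
  have hki : InjOn k U := (injOn_discAut ha).comp hf.injOn hf.mapsTo
  have hkm : MapsTo k U (ball 0 1) := (mapsTo_discAut ha).comp hf.mapsTo
  have hk0 : ∀ z ∈ U, k z ≠ 0 := by
    intro z hz h
    refine haf ⟨z, hz, ?_⟩
    have h1 := discAut_neg_discAut ha (show ‖f z‖ < 1 by simpa using hf.mapsTo hz)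
    rw [show discAut a (f z) = 0 from h, discAut_neg_zero] at h1
    exact h1.symm
  obtain ⟨h, hd, hsq⟩ := exists_differentiableOn_sq_eq hUo hUc hkd hk0
  have hhi : InjOn h U := fun x hx y hy hxy ↦ hki hx hy (by rw [← hsq, ← hsq, hxy])
  have hhm : MapsTo h U (ball 0 1) := by
    intro z hz
    have h1 : ‖k z‖ < 1 := by simpa using hkm hz
    rw [← hsq, norm_pow] at h1
    rw [mem_ball_zero_iff]
    exact (sq_lt_one_iff₀ (norm_nonneg _)).1 h1
  have hb : ‖h z₀‖ < 1 := by simpa using hhm hz₀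
  refine ⟨discAut (h z₀) ∘ h, ⟨(differentiableOn_discAut hb).comp hd hhm,
    (injOn_discAut hb).comp hhi hhm, (mapsTo_discAut hb).comp hhm, by simp⟩, ?_⟩
  have hfd := (hf.differentiableOn.differentiableAt (hUo.mem_nhds hz₀)).hasDerivAt
  have hhd := (hd.differentiableAt (hUo.mem_nhds hz₀)).hasDerivAt
  have hder : HasDerivAt (discAut (h z₀) ∘ h) ((1 - (‖h z₀‖ : ℂ) ^ 2)⁻¹ * deriv h z₀) z₀ := by
    refine HasDerivAt.comp z₀ ?_ hhd
    rw [← deriv_discAut_self hb]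
    exact (hasDerivAt_discAut hb hb).differentiableAt.hasDerivAt
  have hkder : HasDerivAt k ((1 - (‖a‖ : ℂ) ^ 2) * deriv f z₀) z₀ := by
    refine HasDerivAt.comp z₀ ?_ hfd
    rw [hf.map_base]
    simpa using hasDerivAt_discAut (z := 0) ha (by simp)
  have heq : 2 * h z₀ * deriv h z₀ = (1 - (‖a‖ : ℂ) ^ 2) * deriv f z₀ := by
    have h1 := hhd.pow 2
    refine HasDerivAt.unique ?_ hkder
    refine (h1.congr_of_eventuallyEq (Eventually.of_forall fun z ↦ ?_)).congr_deriv (by simp)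
    simp [hsq]
  have hna : ‖a‖ = ‖h z₀‖ ^ 2 := by
    rw [← norm_pow, hsq]
    simp [k, discAut, hf.map_base]
  have hs : 0 < ‖h z₀‖ := norm_pos_iff.2 fun hh ↦ hk0 z₀ hz₀ (by rw [← hsq, hh]; simp)
  have hf0 : 0 < ‖deriv f z₀‖ :=
    norm_pos_iff.2 (deriv_ne_zero_of_injOn hUo hf.differentiableOn hf.injOn hz₀)
  have hneq := congrArg norm heq
  rw [norm_mul, norm_mul, norm_mul, norm_one_sub_normSq ha, hna, Complex.norm_ofNat] at hneq
  rw [hder.deriv, norm_mul, norm_inv, norm_one_sub_normSq hb]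
  set s := ‖h z₀‖
  have h1 : 0 < 1 - s ^ 2 := by nlinarith
  rw [← div_eq_inv_mul, lt_div_iff₀ h1]
  -- With `s = √|a|`, the new derivative is larger by the factor `(1 + s²) / (2s)`, which exceeds
  -- `1` because `(1 - s)² > 0`.
  have h2 : ‖deriv h z₀‖ = (1 - s ^ 2) * ‖deriv f z₀‖ * ((1 + s ^ 2) / (2 * s)) := by
    field_simp
    linear_combination hneq
  rw [h2, mul_comm ‖deriv f z₀‖]
  refine lt_mul_of_one_lt_right (by positivity) ?_
  rw [one_lt_div (by positivity)]
  nlinarith [mul_pos (sub_pos.2 hb) (sub_pos.2 hb)]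

/-- The Riemann mapping theorem. -/
theorem exists_riemann_map (hUo : IsOpen U) (hUc : IsSimplyConnected U) (hU : U ≠ univ) :
    ∃ f : ℂ → ℂ, DifferentiableOn ℂ f U ∧ InjOn f U ∧ f '' U = ball 0 1 := by
  obtain ⟨z₀, hz₀⟩ := hUc.nonempty
  obtain ⟨f₀, hf₀⟩ := exists_isRiemannCompetitor hUo hUc hU hz₀
  set S : Set ℝ := (fun f : ℂ → ℂ ↦ ‖deriv f z₀‖) '' {f | IsRiemannCompetitor U z₀ f}
  have hSne : S.Nonempty := ⟨_, f₀, hf₀, rfl⟩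
  obtain ⟨R, hR, hRU⟩ := Metric.isOpen_iff.1 hUo z₀ hz₀
  have hbdd : BddAbove S := by
    refine ⟨1 / R, ?_⟩
    rintro _ ⟨f, hf, rfl⟩
    refine Complex.norm_deriv_le_div_of_mapsTo_ball (hf.differentiableOn.mono hRU) (fun z hz ↦ ?_) hR
    rw [hf.map_base]
    exact ball_subset_closedBall (hf.mapsTo (hRU hz))
  obtain ⟨u, -, hu, huS⟩ := exists_seq_tendsto_sSup hSne hbdd
  choose F hF hFu using huS
  -- Pointwise limits along an ultrafilter exist by compactness of the closed disk, so no
  -- subsequence has to be extracted.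
  have hlim : ∀ z ∈ U, ∃ w ∈ closedBall (0 : ℂ) 1, Tendsto (F · z) (hyperfilter ℕ : Filter ℕ) (𝓝 w) := by
    intro z hz
    have := (isCompact_closedBall (0 : ℂ) 1).ultrafilter_le_nhds
      ((hyperfilter ℕ).map (F · z)) (by
        rw [le_principal_iff, Ultrafilter.coe_map, Filter.mem_map]
        exact univ_mem' fun n ↦ ball_subset_closedBall ((hF n).mapsTo hz))
    simpa [Tendsto] using this
  choose! g hgb hg using hlim
  have hloc := tendstoLocallyUniformlyOn_of_mapsTo_ball hUo (fun n ↦ (hF n).differentiableOn)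
    (fun n ↦ (hF n).mapsTo) hg
  have hgd : DifferentiableOn ℂ g U :=
    hloc.differentiableOn (Eventually.of_forall fun n ↦ (hF n).differentiableOn) hUo
  have hderiv : ‖deriv g z₀‖ = sSup S := by
    have h1 := ((hloc.deriv (Eventually.of_forall fun n ↦ (hF n).differentiableOn)
      hUo).tendsto_at hz₀).norm
    refine tendsto_nhds_unique h1 ((hu.mono_left Nat.hyperfilter_le_atTop).congr fun n ↦ ?_)
    exact (hFu n).symm
  have hpos : deriv g z₀ ≠ 0 := by
    rw [← norm_pos_iff, hderiv]
    exact (norm_pos_iff.2 (deriv_ne_zero_of_injOn hUo hf₀.differentiableOn hf₀.injOn hz₀)).trans_le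
      (le_csSup hbdd ⟨f₀, hf₀, rfl⟩)
  have hgi : InjOn g U := injOn_of_tendstoLocallyUniformlyOn hUo
    hUc.isPathConnected.isConnected.isPreconnected (fun n ↦ (hF n).differentiableOn)
    (fun n ↦ (hF n).injOn) hloc hz₀ hpos
  -- The limit is only known to lie in the closed disk; its image is open, hence lies in the
  -- interior.
  have hgm : MapsTo g U (ball 0 1) := by
    intro z hz
    have h1 : g '' U ⊆ interior (closedBall 0 1) :=
      interior_maximal (MapsTo.image_subset hgb) (isOpen_image_of_injOn hUo hgd hgi)
    rw [interior_closedBall _ one_ne_zero] at h1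
    exact h1 ⟨z, hz, rfl⟩
  have hgc : IsRiemannCompetitor U z₀ g := by
    refine ⟨hgd, hgi, hgm, tendsto_nhds_unique (hg z₀ hz₀) ?_⟩
    simp_rw [(hF _).map_base]
    exact tendsto_const_nhds
  refine ⟨g, hgd, hgi, hgm.image_subset.antisymm fun a ha ↦ ?_⟩
  by_contra hag
  obtain ⟨k, hk, hlt⟩ := hgc.exists_norm_deriv_lt hUo hUc hz₀ (by simpa using ha) hag
  rw [hderiv] at hlt
  exact hlt.not_ge (le_csSup hbdd ⟨k, hk, rfl⟩)

end RiemannMapping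

/-! ### Path integrals under holomorphic maps -/

section Paths

variable {γ : ℝ → ℂ} {ρ ρ₁ ρ₂ : ℂ → ℝ≥0∞} {U V : Set ℂ} {z w : ℂ}

theorem ae_differentiableAt_of_lipschitzOnWith {K : ℝ≥0} (hγ : LipschitzOnWith K γ (Icc 0 1)) :
    ∀ᵐ t ∂volume.restrict (Icc (0 : ℝ) 1), DifferentiableAt ℝ γ t := by
  rw [← restrict_Ioo_eq_restrict_Icc, ae_restrict_iff' measurableSet_Ioo]
  filter_upwards [hγ.ae_differentiableWithinAt_of_mem_real] with t ht htm
  exact (ht (Ioo_subset_Icc_self htm)).differentiableAt (Icc_mem_nhds htm.1 htm.2)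

theorem ofReal_le_lintegral_of_lipschitzOnWith {u : ℝ → ℝ} {K : ℝ≥0}
    (hu : LipschitzOnWith K u (Icc 0 1)) :
    ENNReal.ofReal (u 1 - u 0) ≤ ∫⁻ t in Icc (0 : ℝ) 1, ‖deriv u t‖ₑ := by
  rw [← uIcc_of_le zero_le_one] at hu
  rw [← hu.absolutelyContinuousOnInterval.integral_deriv_eq_sub,
    intervalIntegral.integral_of_le zero_le_one, ← integral_Icc_eq_integral_Ioc]
  refine (ENNReal.ofReal_le_ofReal (le_abs_self _)).trans ?_
  rw [← Real.enorm_eq_ofReal_abs]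
  exact enorm_integral_le_lintegral_enorm _

theorem enorm_sub_le_lintegral_deriv {K : ℝ≥0} (hγ : LipschitzOnWith K γ (Icc 0 1)) :
    ‖γ 1 - γ 0‖ₑ ≤ ∫⁻ t in Icc (0 : ℝ) 1, ‖deriv γ t‖ₑ := by
  rcases eq_or_ne (γ 1 - γ 0) 0 with h0 | h0
  · simp [h0]
  set v := γ 1 - γ 0
  have hv : 0 < ‖v‖ := norm_pos_iff.2 h0
  -- Orthogonal projection to the direction of `v`: it does not increase norms and sends `v` to
  -- `‖v‖`, which reduces the claim to real functions.
  set L : ℂ →L[ℝ] ℝ := Complex.reCLM ∘L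
    ((ContinuousLinearMap.toSpanSingleton ℂ (starRingEnd ℂ v / ‖v‖)).restrictScalars ℝ)
  have hLdef : ∀ x, L x = (x * (starRingEnd ℂ v / ‖v‖)).re := fun x ↦ by simp [L]
  have hL : ∀ x, ‖L x‖ ≤ ‖x‖ := fun x ↦ by
    rw [hLdef]
    refine (Complex.abs_re_le_norm _).trans_eq ?_
    simp [hv.ne']
  have hLv : L v = ‖v‖ := by
    rw [hLdef, ← mul_div_assoc, Complex.mul_conj']
    norm_cast
    field_simp
  have hlip : LipschitzOnWith K (L ∘ γ) (Icc 0 1) := by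
    have h1 : LipschitzWith 1 L := L.lipschitzWith_of_opNorm_le
      (L.opNorm_le_bound zero_le_one fun x ↦ by simpa using hL x)
    simpa using h1.comp_lipschitzOnWith hγ
  have h1 := ofReal_le_lintegral_of_lipschitzOnWith hlip
  rw [Function.comp_apply, Function.comp_apply, ← map_sub, hLv, ofReal_norm] at h1
  refine h1.trans (lintegral_mono_ae ?_)
  filter_upwards [ae_differentiableAt_of_lipschitzOnWith hγ] with t ht
  rw [(L.hasFDerivAt.comp_hasDerivAt t ht.hasDerivAt).deriv]
  exact enorm_le_iff_norm_le.2 (hL _)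

theorem enorm_sub_le_pathDist_one : ‖w - z‖ₑ ≤ pathDist (fun _ ↦ 1) U z w := by
  refine le_iInf₂ fun γ hγ ↦ ?_
  obtain ⟨K, hK⟩ := hγ.lipschitz
  have := enorm_sub_le_lintegral_deriv hK
  rw [hγ.source, hγ.target] at this
  simpa [lineIntegral] using this

/-- `F` is locally Lipschitz, hence Lipschitz on the compact trace of the path. -/
theorem IsRectifiablePath.comp (hγ : IsRectifiablePath U z w γ) (hU : IsOpen U) {F : ℂ → ℂ}
    (hF : DifferentiableOn ℂ F U) (hm : MapsTo F U V) :
    IsRectifiablePath V (F z) (F w) (F ∘ γ) := by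
  obtain ⟨K, hK⟩ := hγ.lipschitz
  refine ⟨?_, hm.comp hγ.mapsTo, by simp [hγ.source], by simp [hγ.target]⟩
  have hcomp : IsCompact (γ '' Icc 0 1) := isCompact_Icc.image_of_continuousOn hK.continuousOn
  have hloc : LocallyLipschitzOn (γ '' Icc 0 1) F := by
    rintro _ ⟨t, ht, rfl⟩
    obtain ⟨C, s, hs, hCs⟩ := ((hF.analyticAt (hU.mem_nhds (hγ.mapsTo ht))).contDiffAt
      (n := 1)).exists_lipschitzOnWith
    exact ⟨C, s, mem_nhdsWithin_of_mem_nhds hs, hCs⟩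
  obtain ⟨C, hC⟩ := hloc.exists_lipschitzOnWith_of_compact hcomp
  exact ⟨C * K, hC.comp hK (mapsTo_image _ _)⟩

theorem lineIntegral_comp_le (hγ : IsRectifiablePath U z w γ) (hU : IsOpen U) {F : ℂ → ℂ}
    (hF : DifferentiableOn ℂ F U) {C : ℝ≥0∞} (hC : C ≠ ⊤)
    (h : ∀ x ∈ U, ρ₂ (F x) * ‖deriv F x‖ₑ ≤ C * ρ₁ x) :
    lineIntegral ρ₂ (F ∘ γ) ≤ C * lineIntegral ρ₁ γ := by
  obtain ⟨K, hK⟩ := hγ.lipschitz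
  rw [lineIntegral, lineIntegral, ← lintegral_const_mul' _ _ hC]
  refine lintegral_mono_ae ?_
  filter_upwards [ae_differentiableAt_of_lipschitzOnWith hK, ae_restrict_mem measurableSet_Icc]
    with t ht htm
  have hU' := hγ.mapsTo htm
  have hd := (hF.differentiableAt (hU.mem_nhds hU')).hasDerivAt.scomp t ht.hasDerivAt
  rw [hd.deriv, smul_eq_mul, enorm_mul, mul_comm ‖deriv γ t‖ₑ, ← mul_assoc, ← mul_assoc]
  exact mul_le_mul_left (h _ hU') _

/-- Each path in `U` is a competitor in `V` after composition with `F`. All distance comparisons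
between regions rest on this. -/
theorem pathDist_map_le (hU : IsOpen U) {F : ℂ → ℂ} (hF : DifferentiableOn ℂ F U)
    (hm : MapsTo F U V) {C : ℝ≥0∞} (hC0 : C ≠ 0) (hC : C ≠ ⊤)
    (h : ∀ x ∈ U, ρ₂ (F x) * ‖deriv F x‖ₑ ≤ C * ρ₁ x) :
    pathDist ρ₂ V (F z) (F w) ≤ C * pathDist ρ₁ U z w := by
  rw [pathDist, pathDist, ENNReal.mul_iInf_of_ne hC0 hC]
  refine le_iInf fun γ ↦ ?_
  rw [ENNReal.mul_iInf_of_ne hC0 hC]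
  refine le_iInf fun hγ ↦ ?_
  exact (iInf₂_le (F ∘ γ) (hγ.comp hU hF hm)).trans (lineIntegral_comp_le hγ hU hF hC h)

theorem isRectifiablePath_of_contDiff {γ : ℝ → ℂ} (hγ : ContDiff ℝ 1 γ)
    (hm : MapsTo γ (Icc 0 1) U) : IsRectifiablePath U (γ 0) (γ 1) γ :=
  ⟨hγ.contDiffOn.exists_lipschitzOnWith one_ne_zero (convex_Icc 0 1) isCompact_Icc, hm, rfl, rfl⟩

theorem pathDist_le_of_contDiff {γ : ℝ → ℂ} (hγ : ContDiff ℝ 1 γ) (hm : MapsTo γ (Icc 0 1) U)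
    {C : ℝ≥0∞} (h : ∀ t ∈ Icc (0 : ℝ) 1, ρ (γ t) * ‖deriv γ t‖ₑ ≤ C) :
    pathDist ρ U (γ 0) (γ 1) ≤ C := by
  refine (iInf₂_le γ (isRectifiablePath_of_contDiff hγ hm)).trans ?_
  refine (setLIntegral_mono' measurableSet_Icc h).trans ?_
  simp

end Paths

/-! ### Universal coverings of simply connected regions -/

section Covers

variable {p : ℂ → ℂ} {D : Set ℂ}

/-- A conformal map of the unit disk onto `D` is a universal covering. -/
theorem isUniversalCover_of_injOn (hp : DifferentiableOn ℂ p (ball 0 1))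
    (hinj : InjOn p (ball 0 1)) (him : p '' ball 0 1 = D) : IsUniversalCover p D := by
  refine ⟨hp, him, fun x hx ↦ ?_⟩
  set g := Function.invFunOn p (ball 0 1)
  have hg : LeftInvOn g p (ball 0 1) := hinj.leftInvOn_invFunOn
  have hgc : ContinuousOn g D := him ▸ continuousOn_of_leftInvOn isOpen_ball hp hg
  have hpc : Continuous fun ζ : ball (0 : ℂ) 1 ↦ p ζ :=
    continuousOn_iff_continuous_domRestrict.1 hp.continuousOn
  have hDo : IsOpen D := him ▸ isOpen_image_of_injOn isOpen_ball hp hinj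
  have hgm : MapsTo g D (ball 0 1) := by
    rw [← him]
    rintro _ ⟨ζ, hζ, rfl⟩
    rwa [hg hζ]
  have hpg : ∀ y ∈ D, p (g y) = y := by
    rw [← him]
    rintro _ ⟨ζ, hζ, rfl⟩
    rw [hg hζ]
  refine IsEvenlyCovered.to_isEvenlyCovered_preimage (I := Unit) ⟨inferInstance, D, hx, hDo,
    hDo.preimage hpc, ⟨⟨fun e ↦ (⟨p e, e.2⟩, ()), fun y ↦ ⟨⟨g y.1, hgm y.1.2⟩, ?_⟩, ?_, ?_⟩, ?_, ?_⟩,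
    fun _ ↦ rfl⟩
  · simp [hpg y.1 y.1.2]
  · rintro ⟨⟨ζ, hζ⟩, hζ'⟩
    simp [hg hζ]
  · rintro ⟨⟨y, hy⟩, _⟩
    simp [hpg y hy]
  · exact (Continuous.subtype_mk (hpc.comp continuous_subtype_val) _).prodMk continuous_const
  · have h1 : Continuous fun y : D ↦ g y := continuousOn_iff_continuous_domRestrict.1 hgc
    exact ((h1.comp continuous_fst).subtype_mk _).subtype_mk _

/-- A covering of a simply connected region by the unit disk is injective. -/
theorem IsUniversalCover.injOn (hp : IsUniversalCover p D) (hDo : IsOpen D)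
    (hDc : IsSimplyConnected D) : InjOn p (ball 0 1) := by
  have := hDc.simplyConnectedSpace
  have := hDo.locallyPathConnectedSpace
  have := (isSimplyConnected_ball 0 one_pos).simplyConnectedSpace
  have := (isOpen_ball (x := (0 : ℂ)) (ε := 1)).locallyPathConnectedSpace
  have hpm : ∀ ζ : ball (0 : ℂ) 1, p ζ ∈ D := fun ζ ↦ hp.image_eq ▸ mem_image_of_mem p ζ.2
  have hpc : Continuous fun ζ : ball (0 : ℂ) 1 ↦ p ζ :=
    continuousOn_iff_continuous_domRestrict.1 hp.differentiableOn.continuousOn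
  set ζ₀ : ball (0 : ℂ) 1 := ⟨0, by simp⟩
  -- Lifting the inclusion of `D` gives a section `s` of the covering. Both `s ∘ P` and the identity
  -- lift `p` and fix `0`, so they agree by uniqueness and `p` is injective.
  obtain ⟨s, ⟨hs0, hs⟩, -⟩ := hp.isCovering.existsUnique_continuousMap_lifts
    (⟨Subtype.val, continuous_subtype_val⟩ : C(D, ℂ)) (a₀ := ⟨p ζ₀, hpm ζ₀⟩) (e₀ := ζ₀) rfl
    (fun a ↦ a.2)
  have hs' : ∀ y : D, p (s y) = y := fun y ↦ congrFun hs y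
  set P : C(ball (0 : ℂ) 1, D) := ⟨fun ζ ↦ ⟨p ζ, hpm ζ⟩, hpc.subtype_mk _⟩
  obtain ⟨F, -, hF⟩ := hp.isCovering.existsUnique_continuousMap_lifts
    (⟨fun ζ ↦ p ζ, hpc⟩ : C(ball (0 : ℂ) 1, ℂ)) (a₀ := ζ₀) (e₀ := ζ₀) rfl hpm
  have h1 := hF (s.comp P) ⟨hs0, by ext ζ; exact hs' (P ζ)⟩
  have h2 := hF (ContinuousMap.id _) ⟨rfl, rfl⟩
  have h3 : ∀ ζ, s (P ζ) = ζ := fun ζ ↦ by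
    simpa using DFunLike.congr_fun (h1.trans h2.symm) ζ
  intro x hx y hy hxy
  have h4 : P ⟨x, hx⟩ = P ⟨y, hy⟩ := Subtype.ext hxy
  have h5 := h3 ⟨x, hx⟩
  rw [h4, h3] at h5
  exact (congrArg Subtype.val h5).symm

/-- The inverse of a Riemann map serves. -/
theorem IsSimplyConnectedRegion.exists_isUniversalCover (hD : IsSimplyConnectedRegion D) :
    ∃ p, IsUniversalCover p D := by
  obtain ⟨f, hf, hinj, him⟩ := exists_riemann_map hD.isOpen hD.isSimplyConnected hD.ne_univ
  have hl := hinj.leftInvOn_invFunOn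
  refine ⟨Function.invFunOn f D, isUniversalCover_of_injOn ?_ ?_ ?_⟩
  · rw [← him]; exact differentiableOn_of_leftInvOn hD.isOpen hf hl
  · rw [← him]
    exact (hl.rightInvOn_image).injOn
  · rw [← him]; exact hl.image_image

theorem IsUniversalCover.hyperbolicDensity_le (hp : IsUniversalCover p D) {ζ : ℂ} (hζ : ‖ζ‖ < 1) :
    hyperbolicDensity D (p ζ) ≤ ENNReal.ofReal (1 / ((1 - ‖ζ‖ ^ 2) * ‖deriv p ζ‖)) :=
  iInf₂_le_of_le p hp (iInf₂_le_of_le ζ (by simpa using hζ) (iInf_le_of_le rfl le_rfl))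

end Covers

/-! ### Comparison of the two densities and distances -/

section Comparison

variable {p f : ℂ → ℂ} {D : Set ℂ}

/-- A disk without frontier points is covered by the disjoint open sets `Ω` and the complement of
its closure; being connected, it stays in `Ω`. -/
theorem ball_subset_of_le_infEDist_frontier {Ω : Set ℂ} (hΩ : IsOpen Ω) {w : ℂ} (hw : w ∈ Ω) {r : ℝ}
    (hr : ENNReal.ofReal r ≤ infEDist w (frontier Ω)) : ball w r ⊆ Ω := by
  rcases le_or_gt r 0 with h0 | h0
  · simp [ball_eq_empty.2 h0]
  refine (convex_ball w r).isPreconnected.subset_left_of_subset_union hΩ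
    isClosed_closure.isOpen_compl (disjoint_compl_right.mono_right
      (compl_subset_compl.2 subset_closure)) (fun x hx ↦ ?_) ⟨w, mem_ball_self h0, hw⟩
  by_contra hne
  rw [mem_union, not_or, notMem_compl_iff] at hne
  have hfr : x ∈ frontier Ω := ⟨hne.2, fun h ↦ hne.1 (interior_subset h)⟩
  have h1 := hr.trans (infEDist_le_edist_of_mem (x := w) hfr)
  rw [edist_dist, ENNReal.ofReal_le_ofReal_iff dist_nonneg, dist_comm] at h1
  exact h1.not_gt hx

theorem IsConformalMapping.isOpen_image (hf : IsConformalMapping f D) (hD : IsOpen D) :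
    IsOpen (f '' D) :=
  isOpen_image_of_injOn hD hf.differentiableOn hf.injOn

theorem one_sub_normSq_pos {ζ : ℂ} (hζ : ‖ζ‖ < 1) : 0 < 1 - ‖ζ‖ ^ 2 := by
  nlinarith [norm_nonneg ζ]

/-- The Koebe estimate `|f'| / δ_{f(D)} ∘ f ≤ 4 λ_D`. -/
theorem quasihyperbolicDensity_mul_enorm_deriv_le (hD : IsSimplyConnectedRegion D)
    (hf : IsConformalMapping f D) {z : ℂ} (hz : z ∈ D) :
    quasihyperbolicDensity (f '' D) (f z) * ‖deriv f z‖ₑ ≤ 4 * hyperbolicDensity D z := by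
  -- Dividing by `4` isolates the infimum, so that the bound can be checked for each covering and
  -- each preimage.
  rw [← ENNReal.div_le_iff' (by norm_num) (by norm_num)]
  refine le_iInf₂ fun p hp ↦ le_iInf₂ fun ζ hζ ↦ le_iInf fun hpz ↦ ?_
  rw [ENNReal.div_le_iff' (by norm_num) (by norm_num)]
  subst hpz
  have hζ1 : ‖ζ‖ < 1 := by simpa using hζ
  have hpi := hp.injOn hD.isOpen hD.isSimplyConnected
  have hpm : MapsTo p (ball 0 1) D := hp.image_eq ▸ mapsTo_image p _
  have hgd : DifferentiableOn ℂ (f ∘ p) (ball 0 1) := hf.differentiableOn.comp hp.differentiableOn hpm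
  have hgi : InjOn (f ∘ p) (ball 0 1) := hf.injOn.comp hpi hpm
  have hgim : f ∘ p '' ball 0 1 = f '' D := by rw [image_comp, hp.image_eq]
  have hder : deriv (f ∘ p) ζ = deriv f (p ζ) * deriv p ζ :=
    ((hf.differentiableOn.differentiableAt (hD.isOpen.mem_nhds hz)).hasDerivAt.comp ζ
      (hp.differentiableOn.differentiableAt (isOpen_ball.mem_nhds hζ)).hasDerivAt).deriv
  have hf0 : 0 < ‖deriv f (p ζ)‖ :=
    norm_pos_iff.2 (deriv_ne_zero_of_injOn hD.isOpen hf.differentiableOn hf.injOn hz)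
  have hp0 : 0 < ‖deriv p ζ‖ :=
    norm_pos_iff.2 (deriv_ne_zero_of_injOn isOpen_ball hp.differentiableOn hpi hζ)
  have hb := one_sub_normSq_pos hζ1
  have hdist : ENNReal.ofReal ((1 - ‖ζ‖ ^ 2) * (‖deriv f (p ζ)‖ * ‖deriv p ζ‖) / 4) ≤
      infEDist (f (p ζ)) (frontier (f '' D)) := by
    rw [le_infEDist]
    intro a ha
    have hna : a ∉ f ∘ p '' ball 0 1 := by
      rw [hgim]
      exact disjoint_left.1 (disjoint_frontier_iff_isOpen.2 (hf.isOpen_image hD.isOpen)) ha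
    have h1 := koebe_quarter hgd hgi hna hζ1
    rw [hder, norm_mul] at h1
    rw [edist_dist, dist_eq_norm]
    refine ENNReal.ofReal_le_ofReal ?_
    rw [div_le_iff₀' (by norm_num)]
    exact h1
  calc quasihyperbolicDensity (f '' D) (f (p ζ)) * ‖deriv f (p ζ)‖ₑ
      ≤ (ENNReal.ofReal ((1 - ‖ζ‖ ^ 2) * (‖deriv f (p ζ)‖ * ‖deriv p ζ‖) / 4))⁻¹ *
          ‖deriv f (p ζ)‖ₑ := mul_le_mul_left (ENNReal.inv_le_inv.2 hdist) _
    _ = 4 * ENNReal.ofReal (1 / ((1 - ‖ζ‖ ^ 2) * ‖deriv p ζ‖)) := by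
      rw [← ENNReal.ofReal_inv_of_pos (by positivity), ← ofReal_norm,
        ← ENNReal.ofReal_mul (by positivity), ← ENNReal.ofReal_ofNat,
        ← ENNReal.ofReal_mul (by positivity)]
      congr 1
      field_simp

/-- The Schwarz estimate `λ_D ≤ |f'| / δ_{f(D)} ∘ f`, written for the inverse of `f`. -/
theorem hyperbolicDensity_mul_enorm_deriv_le (hD : IsSimplyConnectedRegion D)
    (hf : IsConformalMapping f D) {g : ℂ → ℂ} (hg : LeftInvOn g f D) {y : ℂ} (hy : y ∈ f '' D) :
    hyperbolicDensity D (g y) * ‖deriv g y‖ₑ ≤ quasihyperbolicDensity (f '' D) y := by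
  obtain ⟨z, hz, rfl⟩ := hy
  rw [hg hz]
  obtain ⟨p, hp⟩ := hD.exists_isUniversalCover
  obtain ⟨ζ, hζ, rfl⟩ : z ∈ p '' ball 0 1 := hp.image_eq ▸ hz
  have hζ1 : ‖ζ‖ < 1 := by simpa using hζ
  have hpi := hp.injOn hD.isOpen hD.isSimplyConnected
  have hpm : MapsTo p (ball 0 1) D := hp.image_eq ▸ mapsTo_image p _
  have hder : deriv (f ∘ p) ζ = deriv f (p ζ) * deriv p ζ :=
    ((hf.differentiableOn.differentiableAt (hD.isOpen.mem_nhds hz)).hasDerivAt.comp ζ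
      (hp.differentiableOn.differentiableAt (isOpen_ball.mem_nhds hζ)).hasDerivAt).deriv
  have hgf := deriv_mul_deriv_of_leftInvOn hD.isOpen hf.differentiableOn hg hz
  have hf0 : 0 < ‖deriv f (p ζ)‖ := norm_pos_iff.2 (right_ne_zero_of_mul_eq_one hgf)
  have hp0 : 0 < ‖deriv p ζ‖ :=
    norm_pos_iff.2 (deriv_ne_zero_of_injOn isOpen_ball hp.differentiableOn hpi hζ)
  have hb := one_sub_normSq_pos hζ1
  have hgn : ‖deriv g (f (p ζ))‖ = ‖deriv f (p ζ)‖⁻¹ := by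
    rw [eq_inv_of_mul_eq_one_left hgf, norm_inv]
  refine (mul_le_mul_left (hp.hyperbolicDensity_le hζ1) _).trans ?_
  rw [← ofReal_norm, hgn, ← ENNReal.ofReal_mul (by positivity),
    show 1 / ((1 - ‖ζ‖ ^ 2) * ‖deriv p ζ‖) * ‖deriv f (p ζ)‖⁻¹ =
      ((1 - ‖ζ‖ ^ 2) * (‖deriv f (p ζ)‖ * ‖deriv p ζ‖))⁻¹ by field_simp,
    ENNReal.ofReal_inv_of_pos (by positivity), quasihyperbolicDensity, ENNReal.inv_le_inv]
  -- Testing finite radii below the distance avoids a separate treatment of the value `∞`.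
  refine ENNReal.le_of_forall_nnreal_lt fun r hr ↦ ?_
  rcases eq_or_ne r 0 with rfl | hr0
  · simp
  have hball := ball_subset_of_le_infEDist_frontier (hf.isOpen_image hD.isOpen)
    (mem_image_of_mem f hz) (r := r) (by simpa using hr.le)
  rw [← hp.image_eq, ← image_comp] at hball
  have h1 := radius_le_of_ball_subset_image (f := f ∘ p)
    (hf.differentiableOn.comp hp.differentiableOn hpm)
    (hf.injOn.comp hpi hpm) hζ1 (NNReal.coe_pos.2 (pos_iff_ne_zero.2 hr0)) hball
  rw [hder, norm_mul] at h1
  rw [← ENNReal.ofReal_coe_nnreal]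
  exact ENNReal.ofReal_le_ofReal h1

theorem hyperbolicDist_le_quasihyperbolicDist (hD : IsSimplyConnectedRegion D)
    (hf : IsConformalMapping f D) {z₁ z₂ : ℂ} (h₁ : z₁ ∈ D) (h₂ : z₂ ∈ D) :
    hyperbolicDist D z₁ z₂ ≤ quasihyperbolicDist (f '' D) (f z₁) (f z₂) := by
  have hg : LeftInvOn (Function.invFunOn f D) f D := hf.injOn.leftInvOn_invFunOn
  have hgm : MapsTo (Function.invFunOn f D) (f '' D) D := by
    rintro _ ⟨z, hz, rfl⟩
    rwa [hg hz]
  have h := pathDist_map_le (ρ₁ := quasihyperbolicDensity (f '' D)) (ρ₂ := hyperbolicDensity D)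
    (z := f z₁) (w := f z₂) (hf.isOpen_image hD.isOpen)
    (differentiableOn_of_leftInvOn hD.isOpen hf.differentiableOn hg) hgm one_ne_zero
    ENNReal.one_ne_top fun y hy ↦ by
      rw [one_mul]; exact hyperbolicDensity_mul_enorm_deriv_le hD hf hg hy
  rwa [hg h₁, hg h₂, one_mul] at h

theorem quasihyperbolicDist_le_four_mul_hyperbolicDist (hD : IsSimplyConnectedRegion D)
    (hf : IsConformalMapping f D) (z₁ z₂ : ℂ) :
    quasihyperbolicDist (f '' D) (f z₁) (f z₂) ≤ 4 * hyperbolicDist D z₁ z₂ :=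
  pathDist_map_le hD.isOpen hf.differentiableOn (mapsTo_image f D) (by norm_num) (by norm_num)
    fun _ hz ↦ quasihyperbolicDensity_mul_enorm_deriv_le hD hf hz

theorem hyperbolicDist_lt_top (hD : IsSimplyConnectedRegion D) {z₁ z₂ : ℂ} (h₁ : z₁ ∈ D)
    (h₂ : z₂ ∈ D) : hyperbolicDist D z₁ z₂ < ⊤ := by
  obtain ⟨p, hp⟩ := hD.exists_isUniversalCover
  obtain ⟨a, ha, rfl⟩ : z₁ ∈ p '' ball 0 1 := hp.image_eq ▸ h₁
  obtain ⟨b, hb, rfl⟩ : z₂ ∈ p '' ball 0 1 := hp.image_eq ▸ h₂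
  have hpi := hp.injOn hD.isOpen hD.isSimplyConnected
  have hpm : MapsTo p (ball 0 1) D := hp.image_eq ▸ mapsTo_image p _
  rw [mem_ball_zero_iff] at ha hb
  -- On the disk of radius `r` the pulled back density is at most `1 / (1 - r²)`, so the image under
  -- `p` of the segment from `a` to `b` has finite length.
  obtain ⟨r, hr, hr1⟩ := exists_between (max_lt ha hb)
  have hr0 : 0 < r := (norm_nonneg a).trans_lt ((le_max_left _ _).trans_lt hr)
  have har : a ∈ ball (0 : ℂ) r := by simpa using (le_max_left _ _).trans_lt hr
  have hbr : b ∈ ball (0 : ℂ) r := by simpa using (le_max_right _ _).trans_lt hr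
  have hsub : ball (0 : ℂ) r ⊆ ball 0 1 := ball_subset_ball hr1.le
  have hmap := pathDist_map_le (ρ₁ := fun _ ↦ ENNReal.ofReal (1 / (1 - r ^ 2)))
    (ρ₂ := hyperbolicDensity D) (z := a) (w := b) isOpen_ball (hp.differentiableOn.mono hsub)
    (hpm.mono_left hsub) one_ne_zero ENNReal.one_ne_top fun ζ hζ ↦ by
      have hζr : ‖ζ‖ < r := by simpa using hζ
      have hζ1 : ‖ζ‖ < 1 := hζr.trans hr1
      have hp0 : 0 < ‖deriv p ζ‖ :=
        norm_pos_iff.2 (deriv_ne_zero_of_injOn isOpen_ball hp.differentiableOn hpi (hsub hζ))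
      have hpos := one_sub_normSq_pos hζ1
      have hpos' : 0 < 1 - r ^ 2 := by nlinarith
      rw [one_mul]
      refine (mul_le_mul_left (hp.hyperbolicDensity_le hζ1) _).trans ?_
      rw [← ofReal_norm, ← ENNReal.ofReal_mul (by positivity)]
      refine ENNReal.ofReal_le_ofReal ?_
      rw [show 1 / ((1 - ‖ζ‖ ^ 2) * ‖deriv p ζ‖) * ‖deriv p ζ‖ = 1 / (1 - ‖ζ‖ ^ 2) by field_simp]
      exact one_div_le_one_div_of_le hpos' (by gcongr)
  refine hmap.trans_lt ?_
  rw [one_mul]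
  have hseg := pathDist_le_of_contDiff (ρ := fun _ ↦ ENNReal.ofReal (1 / (1 - r ^ 2)))
    (U := ball (0 : ℂ) r) (γ := fun t : ℝ ↦ a + t * (b - a))
    (C := ENNReal.ofReal (1 / (1 - r ^ 2)) * ‖b - a‖ₑ)
    (contDiff_const.add (Complex.ofRealCLM.contDiff.mul contDiff_const)) (fun t ht ↦ ?_) fun t _ ↦ ?_
  · simp only [Complex.ofReal_zero, zero_mul, add_zero, Complex.ofReal_one, one_mul,
      add_sub_cancel] at hseg
    exact hseg.trans_lt (ENNReal.mul_lt_top ENNReal.ofReal_lt_top enorm_lt_top)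
  · have := (convex_ball (0 : ℂ) r).add_smul_sub_mem har hbr ht
    simpa using this
  · have hd : HasDerivAt (fun t : ℝ ↦ a + t * (b - a)) (b - a) t := by
      simpa using ((Complex.ofRealCLM.hasDerivAt (x := t)).mul_const (b - a)).const_add a
    rw [hd.deriv]

end Comparison

/-! ### Sharpness of the constant 1: the unit disk -/

section UnitDisk

theorem isSimplyConnectedRegion_unitDisk : IsSimplyConnectedRegion (ball 0 1) :=
  ⟨isOpen_ball, isSimplyConnected_ball 0 one_pos, fun h ↦ by
    have : (1 : ℂ) ∈ ball (0 : ℂ) 1 := h ▸ mem_univ _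
    simp at this⟩

theorem isConformalMapping_id (D : Set ℂ) : IsConformalMapping id D :=
  ⟨differentiableOn_id, injOn_id D⟩

theorem one_le_hyperbolicDensity_unitDisk (w : ℂ) : 1 ≤ hyperbolicDensity (ball 0 1) w := by
  refine le_iInf₂ fun p hp ↦ le_iInf₂ fun ζ hζ ↦ le_iInf fun _ ↦ ?_
  have hζ1 : ‖ζ‖ < 1 := by simpa using hζ
  have hp0 : 0 < ‖deriv p ζ‖ := norm_pos_iff.2 (deriv_ne_zero_of_injOn isOpen_ball
    hp.differentiableOn (hp.injOn isOpen_ball (isSimplyConnected_ball 0 one_pos)) hζ)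
  have hb := one_sub_normSq_pos hζ1
  have h1 := norm_deriv_mul_le_one_of_mapsTo hp.differentiableOn
    (mapsTo_iff_image_subset.2 hp.image_eq.subset) hζ1
  rw [ENNReal.one_le_ofReal]
  exact (one_le_div (by positivity)).2 h1

theorem le_hyperbolicDist_unitDisk (z w : ℂ) : ‖w - z‖ₑ ≤ hyperbolicDist (ball 0 1) z w := by
  refine (enorm_sub_le_pathDist_one (U := ball 0 1)).trans ?_
  refine iInf₂_mono fun γ _ ↦ lintegral_mono fun t ↦ ?_
  exact mul_le_mul_left (one_le_hyperbolicDensity_unitDisk _) _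

/-- Along the radial segment the distance to the circle is at least `1 - x`. -/
theorem quasihyperbolicDist_unitDisk_le {x : ℝ} (hx0 : 0 ≤ x) (hx1 : x < 1) :
    quasihyperbolicDist (ball 0 1) 0 x ≤ ENNReal.ofReal (x / (1 - x)) := by
  have h := pathDist_le_of_contDiff (ρ := quasihyperbolicDensity (ball 0 1)) (U := ball (0 : ℂ) 1)
    (γ := fun t : ℝ ↦ (t * x : ℂ)) (C := ENNReal.ofReal (x / (1 - x)))
    (Complex.ofRealCLM.contDiff.mul contDiff_const) (fun t ht ↦ ?_) fun t ht ↦ ?_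
  · simpa [quasihyperbolicDist] using h
  · simp only [mem_ball_zero_iff, norm_mul, Complex.norm_real, Real.norm_eq_abs, abs_of_nonneg hx0,
      abs_of_nonneg ht.1]
    nlinarith [ht.2]
  · have hd : HasDerivAt (fun t : ℝ ↦ (t * x : ℂ)) x t := by
      simpa using (Complex.ofRealCLM.hasDerivAt (x := t)).mul_const (x : ℂ)
    have hpos : 0 < 1 - x := by linarith
    have hdist : ENNReal.ofReal (1 - x) ≤ infEDist (t * x : ℂ) (frontier (ball 0 1)) := by
      rw [le_infEDist, frontier_ball _ one_ne_zero]
      intro a ha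
      rw [edist_dist, dist_comm, dist_eq_norm]
      refine ENNReal.ofReal_le_ofReal ?_
      have h1 := norm_sub_norm_le a (t * x : ℂ)
      rw [mem_sphere_zero_iff_norm.1 ha, norm_mul, Complex.norm_real, Complex.norm_real,
        Real.norm_of_nonneg hx0, Real.norm_of_nonneg ht.1] at h1
      nlinarith [ht.2]
    rw [hd.deriv, quasihyperbolicDensity]
    refine (mul_le_mul_left (ENNReal.inv_le_inv.2 hdist) _).trans ?_
    rw [← ENNReal.ofReal_inv_of_pos hpos, ← ofReal_norm, Complex.norm_real, Real.norm_of_nonneg hx0,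
      ← ENNReal.ofReal_mul (by positivity), ← div_eq_inv_mul]

end UnitDisk

/-! ### Sharpness of the constant 4: the slit plane -/

section SlitPlane

open Complex (slitPlane)

theorem isSimplyConnectedRegion_slitPlane : IsSimplyConnectedRegion slitPlane := by
  refine ⟨Complex.isOpen_slitPlane, ?_, fun h ↦ ?_⟩
  · have := Complex.starConvex_one_slitPlane.contractibleSpace ⟨1, Complex.one_mem_slitPlane⟩
    exact inferInstanceAs (SimplyConnectedSpace slitPlane)
  · exact Complex.zero_notMem_slitPlane (h ▸ mem_univ _)

theorem zero_mem_frontier_slitPlane : (0 : ℂ) ∈ frontier slitPlane := by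
  rw [Complex.isOpen_slitPlane.frontier_eq]
  refine ⟨Metric.mem_closure_iff.2 fun ε hε ↦ ⟨((ε / 2 : ℝ) : ℂ), ?_, ?_⟩,
    Complex.zero_notMem_slitPlane⟩
  · exact Complex.ofReal_mem_slitPlane.2 (by positivity)
  · rw [dist_zero_left, Complex.norm_real, Real.norm_of_nonneg (by positivity)]
    linarith

/-- Since `0` is a boundary point, `δ(x) ≤ |x|`, so the quasihyperbolic density dominates `|log'|`.
-/
theorem enorm_log_le_quasihyperbolicDist_slitPlane (z w : ℂ) :
    ‖Complex.log w - Complex.log z‖ₑ ≤ quasihyperbolicDist slitPlane z w := by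
  have h := pathDist_map_le (ρ₁ := quasihyperbolicDensity slitPlane) (ρ₂ := fun _ ↦ 1)
    (F := Complex.log) (V := univ) (z := z) (w := w) Complex.isOpen_slitPlane
    (fun x hx ↦ (Complex.differentiableAt_log hx).differentiableWithinAt) (mapsTo_univ _ _)
    one_ne_zero ENNReal.one_ne_top fun x hx ↦ by
      have hx0 : x ≠ 0 := Complex.slitPlane_ne_zero hx
      rw [(Complex.hasDerivAt_log hx).deriv, one_mul, one_mul, enorm_inv hx0,
        quasihyperbolicDensity, ENNReal.inv_le_inv]
      refine (infEDist_le_edist_of_mem zero_mem_frontier_slitPlane).trans_eq ?_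
      rw [edist_zero_right]
  rw [one_mul] at h
  exact enorm_sub_le_pathDist_one.trans h

/-- The Koebe function, normalized to map the unit disk onto the slit plane. -/
noncomputable def slitKoebe (ζ : ℂ) : ℂ := ((1 + ζ) / (1 - ζ)) ^ 2

theorem one_sub_ne_zero_of_norm_lt_one {ζ : ℂ} (hζ : ‖ζ‖ < 1) : 1 - ζ ≠ 0 := by
  intro h
  rw [← sub_eq_zero.1 h] at hζ
  simp at hζ

theorem hasDerivAt_slitKoebe {ζ : ℂ} (hζ : ‖ζ‖ < 1) :
    HasDerivAt slitKoebe (4 * (1 + ζ) / (1 - ζ) ^ 3) ζ := by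
  have h0 := one_sub_ne_zero_of_norm_lt_one hζ
  have h1 : HasDerivAt (fun ζ : ℂ ↦ 1 + ζ) 1 ζ := (hasDerivAt_id ζ).const_add 1
  have h2 : HasDerivAt (fun ζ : ℂ ↦ 1 - ζ) (-1) ζ := (hasDerivAt_id ζ).const_sub 1
  refine ((h1.div h2 h0).pow 2).congr_deriv ?_
  simp
  field_simp
  ring

theorem re_cayley_pos {ζ : ℂ} (hζ : ‖ζ‖ < 1) : 0 < ((1 + ζ) / (1 - ζ)).re := by
  have h0 := one_sub_ne_zero_of_norm_lt_one hζ
  have h1 : 0 < Complex.normSq (1 - ζ) := Complex.normSq_pos.2 h0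
  have h2 : Complex.normSq ζ < 1 := by
    rw [Complex.normSq_eq_norm_sq]; nlinarith [norm_nonneg ζ]
  rw [Complex.div_re, ← add_div]
  refine div_pos ?_ h1
  rw [Complex.normSq_apply] at h2
  simp
  nlinarith

theorem sq_mem_slitPlane {s : ℂ} (hs : 0 < s.re) : s ^ 2 ∈ slitPlane := by
  rw [Complex.mem_slitPlane_iff, sq, Complex.mul_re, Complex.mul_im]
  by_cases h : s.im = 0
  · left
    rw [h]
    nlinarith
  · right
    have : s.re * s.im ≠ 0 := mul_ne_zero hs.ne' h
    intro h'
    exact this (by linarith)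

theorem cayley_inverse {s : ℂ} (hs : 0 < s.re) :
    ‖(s - 1) / (s + 1)‖ < 1 ∧ (1 + (s - 1) / (s + 1)) / (1 - (s - 1) / (s + 1)) = s := by
  have h1 : s + 1 ≠ 0 := fun h ↦ by
    have := congrArg Complex.re h
    simp at this
    linarith
  refine ⟨?_, ?_⟩
  · rw [norm_div, div_lt_one (norm_pos_iff.2 h1)]
    refine lt_of_pow_lt_pow_left₀ 2 (norm_nonneg _) ?_
    rw [← Complex.normSq_eq_norm_sq, ← Complex.normSq_eq_norm_sq, Complex.normSq_apply,
      Complex.normSq_apply]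
    simp
    nlinarith
  · rw [show 1 + (s - 1) / (s + 1) = 2 * s / (s + 1) by field_simp; ring,
      show 1 - (s - 1) / (s + 1) = 2 / (s + 1) by field_simp; ring]
    field_simp

theorem isUniversalCover_slitKoebe : IsUniversalCover slitKoebe slitPlane := by
  refine isUniversalCover_of_injOn (fun ζ hζ ↦ (hasDerivAt_slitKoebe
    (by simpa using hζ)).differentiableAt.differentiableWithinAt) (fun x hx y hy hxy ↦ ?_) ?_
  · have hx1 : ‖x‖ < 1 := by simpa using hx
    have hy1 : ‖y‖ < 1 := by simpa using hy
    have h1 := re_cayley_pos hx1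
    have h2 := re_cayley_pos hy1
    rcases sq_eq_sq_iff_eq_or_eq_neg.1 hxy with h | h
    · rw [div_eq_div_iff (one_sub_ne_zero_of_norm_lt_one hx1)
        (one_sub_ne_zero_of_norm_lt_one hy1)] at h
      linear_combination h / 2
    · rw [h, Complex.neg_re] at h1
      linarith
  · refine Subset.antisymm ?_ fun w hw ↦ ?_
    · rintro _ ⟨ζ, hζ, rfl⟩
      exact sq_mem_slitPlane (re_cayley_pos (by simpa using hζ))
    · have hs : 0 < (Complex.exp (Complex.log w / 2)).re := by
        rw [Complex.exp_re]
        refine mul_pos (Real.exp_pos _) (Real.cos_pos_of_mem_Ioo ?_)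
        have h1 := Complex.neg_pi_lt_arg w
        have h2 := (Complex.arg_le_pi w).lt_of_ne (Complex.mem_slitPlane_iff_arg.1 hw).1
        have h3 : (Complex.log w / 2).im = w.arg / 2 := by
          rw [Complex.div_ofNat_im, Complex.log_im]
        rw [h3]
        exact ⟨by linarith, by linarith⟩
      obtain ⟨h1, h2⟩ := cayley_inverse hs
      refine ⟨_, mem_ball_zero_iff.2 h1, ?_⟩
      rw [slitKoebe, h2, ← Complex.exp_nat_mul, Nat.cast_ofNat, mul_div_cancel₀ _ two_ne_zero,
        Complex.exp_log (Complex.slitPlane_ne_zero hw)]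

theorem hyperbolicDensity_slitPlane_le {x : ℝ} (hx : 0 < x) :
    hyperbolicDensity slitPlane ((x ^ 2 : ℝ) : ℂ) ≤ ENNReal.ofReal (1 / (4 * x ^ 2)) := by
  set t : ℝ := (x - 1) / (x + 1)
  have hcay := cayley_inverse (s := (x : ℂ)) (by simpa using hx)
  have ht : ((x : ℂ) - 1) / (x + 1) = (t : ℂ) := by simp [t]
  rw [ht] at hcay
  have hval : slitKoebe t = ((x ^ 2 : ℝ) : ℂ) := by
    rw [slitKoebe, hcay.2]; push_cast; rfl
  have h := isUniversalCover_slitKoebe.hyperbolicDensity_le hcay.1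
  rw [hval] at h
  refine h.trans_eq ?_
  have hder : deriv slitKoebe t = ((4 * (1 + t) / (1 - t) ^ 3 : ℝ) : ℂ) := by
    rw [(hasDerivAt_slitKoebe hcay.1).deriv]; push_cast; rfl
  have h1 : 1 + t = 2 * x / (x + 1) := by simp only [t]; field_simp; ring
  have h2 : 1 - t = 2 / (x + 1) := by simp only [t]; field_simp; ring
  have h3 : 0 < 4 * (1 + t) / (1 - t) ^ 3 := by rw [h1, h2]; positivity
  rw [hder, Complex.norm_real, Complex.norm_real, Real.norm_of_nonneg h3.le, Real.norm_eq_abs,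
    sq_abs, show 1 - t ^ 2 = (1 + t) * (1 - t) by ring, h1, h2]
  congr 1
  field_simp

/-- Along `t ↦ exp t` the speed `exp t` cancels the density bound `1 / (4 exp t)`, leaving `1 / 4`.
-/
theorem hyperbolicDist_slitPlane_le :
    hyperbolicDist slitPlane 1 (Real.exp 1 : ℝ) ≤ ENNReal.ofReal (1 / 4) := by
  have h := pathDist_le_of_contDiff (ρ := hyperbolicDensity slitPlane) (U := slitPlane)
    (γ := fun t : ℝ ↦ ((Real.exp t : ℝ) : ℂ)) (C := ENNReal.ofReal (1 / 4))
    (Complex.ofRealCLM.contDiff.comp Real.contDiff_exp)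
    (fun t _ ↦ Complex.ofReal_mem_slitPlane.2 (Real.exp_pos t)) fun t _ ↦ ?_
  · simpa only [hyperbolicDist, Real.exp_zero, Complex.ofReal_one] using h
  · rw [(Real.hasDerivAt_exp t).ofReal_comp.deriv]
    have hsq : Real.exp t = Real.exp (t / 2) ^ 2 := by
      rw [← Real.exp_nat_mul]; congr 1; push_cast; ring
    have h1 := hyperbolicDensity_slitPlane_le (Real.exp_pos (t / 2))
    rw [← hsq] at h1
    refine (mul_le_mul_left h1 _).trans_eq ?_
    rw [← ofReal_norm, Complex.norm_real, Real.norm_of_nonneg (Real.exp_pos t).le,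
      ← ENNReal.ofReal_mul (by positivity)]
    congr 1
    have := Real.exp_pos t
    field_simp

theorem one_le_quasihyperbolicDist_slitPlane :
    1 ≤ quasihyperbolicDist slitPlane 1 (Real.exp 1 : ℝ) := by
  have h := enorm_log_le_quasihyperbolicDist_slitPlane 1 (Real.exp 1 : ℝ)
  rw [← Complex.ofReal_log (Real.exp_pos 1).le, Real.log_exp] at h
  simpa using h

end SlitPlane

end HypMetric

theorem corollary2p2 :
    (∀ (D : Set ℂ) (f : ℂ → ℂ), HypMetric.IsSimplyConnectedRegion D →
      HypMetric.IsConformalMapping f D → ∀ z₁ ∈ D, ∀ z₂ ∈ D,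
        HypMetric.hyperbolicDist D z₁ z₂ < ⊤ ∧
        HypMetric.quasihyperbolicDist (f '' D) (f z₁) (f z₂) < ⊤ ∧
        HypMetric.hyperbolicDist D z₁ z₂ ≤
          HypMetric.quasihyperbolicDist (f '' D) (f z₁) (f z₂) ∧
        HypMetric.quasihyperbolicDist (f '' D) (f z₁) (f z₂) ≤
          4 * HypMetric.hyperbolicDist D z₁ z₂) ∧
    -- the constant `1` on the left cannot be enlarged
    (∀ c : ℝ≥0,
      (∀ (D : Set ℂ) (f : ℂ → ℂ), HypMetric.IsSimplyConnectedRegion D →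
        HypMetric.IsConformalMapping f D → ∀ z₁ ∈ D, ∀ z₂ ∈ D,
          (c : ℝ≥0∞) * HypMetric.hyperbolicDist D z₁ z₂ ≤
            HypMetric.quasihyperbolicDist (f '' D) (f z₁) (f z₂)) → c ≤ 1) ∧
    -- the constant `4` on the right cannot be diminished
    (∀ C : ℝ≥0,
      (∀ (D : Set ℂ) (f : ℂ → ℂ), HypMetric.IsSimplyConnectedRegion D →
        HypMetric.IsConformalMapping f D → ∀ z₁ ∈ D, ∀ z₂ ∈ D,
          HypMetric.quasihyperbolicDist (f '' D) (f z₁) (f z₂) ≤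
            (C : ℝ≥0∞) * HypMetric.hyperbolicDist D z₁ z₂) → 4 ≤ C) := by
  refine ⟨fun D f hD hf z₁ h₁ z₂ h₂ ↦ ?_, fun c hc ↦ ?_, fun C hC ↦ ?_⟩
  · have hfin := HypMetric.hyperbolicDist_lt_top hD h₁ h₂
    have hle := HypMetric.quasihyperbolicDist_le_four_mul_hyperbolicDist hD hf z₁ z₂
    exact ⟨hfin, hle.trans_lt (ENNReal.mul_lt_top (by norm_num) hfin),
      HypMetric.hyperbolicDist_le_quasihyperbolicDist hD hf h₁ h₂, hle⟩
  · by_contra! hc1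
    have hc1' : (1 : ℝ) < c := by exact_mod_cast hc1
    -- The disk estimates give `c * x ≤ x / (1 - x)`, that is `c * (1 - x) ≤ 1`; this fails once `x
    -- < 1 - c⁻¹`.
    obtain ⟨x, hx0, hx⟩ : ∃ x : ℝ, 0 < x ∧ x < 1 - (c : ℝ)⁻¹ :=
      exists_between (by linarith [inv_lt_one_of_one_lt₀ hc1'])
    have hcinv : 0 < (c : ℝ)⁻¹ := by positivity
    have hx1 : x < 1 := by linarith
    have h := hc (ball 0 1) id HypMetric.isSimplyConnectedRegion_unitDisk
      (HypMetric.isConformalMapping_id _) 0 (by simp) x (by simp [abs_of_pos hx0, hx1])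
    rw [image_id, id, id] at h
    have h1 := ((mul_le_mul_right (HypMetric.le_hyperbolicDist_unitDisk 0 x) (c : ℝ≥0∞)).trans
      h).trans (HypMetric.quasihyperbolicDist_unitDisk_le hx0.le hx1)
    have hpos : 0 < 1 - x := by linarith
    rw [sub_zero, ← ofReal_norm, Complex.norm_real, Real.norm_of_nonneg hx0.le,
      ← ENNReal.ofReal_coe_nnreal, ← ENNReal.ofReal_mul c.coe_nonneg,
      ENNReal.ofReal_le_ofReal_iff (by positivity), le_div_iff₀ hpos] at h1
    have h2 : (c : ℝ) * (1 - x) ≤ 1 := by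
      nlinarith
    have h3 : (c : ℝ) * (c : ℝ)⁻¹ = 1 := mul_inv_cancel₀ (by positivity)
    nlinarith
  · have h := hC Complex.slitPlane id HypMetric.isSimplyConnectedRegion_slitPlane
      (HypMetric.isConformalMapping_id _) 1 Complex.one_mem_slitPlane (Real.exp 1 : ℝ)
      (Complex.ofReal_mem_slitPlane.2 (Real.exp_pos 1))
    rw [image_id, id, id] at h
    -- The chain is `1 ≤ k ≤ C h ≤ C / 4`.
    have h1 := (HypMetric.one_le_quasihyperbolicDist_slitPlane.trans h).trans
      (mul_le_mul_right HypMetric.hyperbolicDist_slitPlane_le (C : ℝ≥0∞))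
    rw [← ENNReal.ofReal_coe_nnreal, ← ENNReal.ofReal_mul C.coe_nonneg, ENNReal.one_le_ofReal] at h1
    have h2 : (4 : ℝ) ≤ C := by linarith
    exact_mod_cast h2
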